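/- Let $d\ge 2$ and let $\Omega\subsetneq\mathbb R^d$ be a nonempty open set, bounded or unbounded (connectedness is not needed), that is a Lipschitz (minimally smooth) domain: there are $\varepsilon>0$, $N\in\mathbb N$, $M\ge 0$ and a countable family of open sets $U_j\subset\mathbb R^d$ such that every ball $B_\varepsilon(x)$ with $x\in\partial\Omega$ is contained in some $U_j$, every point lies in at most $N$ of the sets $U_j$, and for each $j$ one has $U_j\cap\Omega=U_j\cap\Omega_j$ for some $\Omega_j$ which in suitable Cartesian coordinates $(x,t)\in\mathbb R^{d-1}\times\mathbb R$ is the set $\{t>\varphi_j(x)\}$, where $\varphi_j:\mathbb R^{d-1}\to\mathbb R$ is Lipschitz with constant $M$. For $\beta\ge 0$ let $-\Delta_\beta^\Omega$ be the Robin Laplacian, that is, the operator in $L^2(\Omega)$ that corresponds by the first representation theorem to the form $$\mathfrak t_\beta^\Omega[f,g]=(\nabla f,\nabla g)_{L^2(\Omega;\mathbb C^d)}-\beta\,(f|_{\partial\Omega},g|_{\partial\Omega})_{L^2(\partial\Omega)},\qquad \operatorname{dom}\mathfrak t_\beta^\Omega=H^1(\Omega),$$ where $f|_{\partial\Omega}$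 is the trace of $f$. Set $F_\Omega(\beta)=\inf\sigma(-\Delta_\beta^\Omega)$. For every $\beta\ge0$ the spectrum $\sigma(-\Delta_\beta^\Omega)$ is real, nonempty and bounded from below, so that $F_\Omega(\beta)\in\mathbb R$, and $$F_\Omega(\beta)=\inf\{\mathfrak t_\beta^\Omega[f,f]: f\in H^1(\Omega),\ \|f\|_{L^2(\Omega)}=1\}.$$ The function $F_\Omega:[0,\infty)\to\mathbb R$ has the following properties. 1. $F_\Omega$ is non-increasing. Moreover, if $\beta_1\ge0$ and $F_\Omega(\beta_1)<0$, then $F_\Omega(\beta_2)<F_\Omega(\beta_1)$ for every $\beta_2>\beta_1$. 2. $F_\Omega$ is continuous. 3. $F_\Omega(0)\ge 0$. 4. $\lim_{\beta\to+\infty}F_\Omega(\beta)=-\infty$. Consequently the equation $F_\Omega(\beta)=-1$ has a unique strictly positive solution, denoted $\beta(\Omega)$. -/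

import Mathlib

open MeasureTheory Filter Topology
open scoped ContDiff NNReal ENNReal

namespace RobinLaplacian

/-- Euclidean space of dimension `d`. -/
abbrev Eucl (d : ℕ) : Type := EuclideanSpace ℝ (Fin d)

/-! ### Lipschitz domains -/

/-- The special Lipschitz domain `{(x, t) : t > ψ x}`, where `(x, t) = e p` are the coordinates of
the point `p` in the Cartesian coordinate system `e`. -/
def specialDomain {d : ℕ} (e : Eucl d ≃ᵢ WithLp 2 (Eucl (d - 1) × ℝ)) (ψ : Eucl (d - 1) → ℝ) :
    Set (Eucl d) :=
  {p | ψ (e p).fst < (e p).snd}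

/-- Lipschitz (minimally smooth) domains, bounded or unbounded. For a Lipschitz function `ψ`, the
bound `‖∇ψ‖_∞ ≤ M` says that `M` is a Lipschitz constant of `ψ`. Connectedness is not required. -/
structure IsLipschitzDomain {d : ℕ} (Ω : Set (Eucl d)) : Prop where
  isOpen : IsOpen Ω
  nonempty : Ω.Nonempty
  exists_cover : ∃ (ε : ℝ) (N : ℕ) (M : ℝ≥0) (ι : Type) (_ : Countable ι) (U : ι → Set (Eucl d)),
    0 < ε ∧ (∀ j, IsOpen (U j)) ∧
    (∀ x ∈ frontier Ω, ∃ j, Metric.ball x ε ⊆ U j) ∧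
    (∀ x, {j | x ∈ U j}.encard ≤ N) ∧
    (∀ j, ∃ (e : Eucl d ≃ᵢ WithLp 2 (Eucl (d - 1) × ℝ)) (ψ : Eucl (d - 1) → ℝ),
      LipschitzWith M ψ ∧ U j ∩ Ω = U j ∩ specialDomain e ψ)

/-! ### The Sobolev space `H¹(Ω)` -/

/-- `L²(Ω)`, complex-valued. -/
abbrev L2 {d : ℕ} (Ω : Set (Eucl d)) : Type := Lp ℂ 2 (volume.restrict Ω)

/-- `L²(Ω; ℂᵈ)`. -/
abbrev L2Vec {d : ℕ} (Ω : Set (Eucl d)) : Type :=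
  Lp (EuclideanSpace ℂ (Fin d)) 2 (volume.restrict Ω)

/-- The surface measure on `∂Ω`: the `(d - 1)`-dimensional Hausdorff measure, normalised so as to
agree with Lebesgue measure on `ℝᵈ⁻¹`. -/
noncomputable def surfaceMeasure {d : ℕ} (Ω : Set (Eucl d)) : Measure (Eucl d) :=
  (Measure.euclideanHausdorffMeasure (d - 1)).restrict (frontier Ω)

/-- `L²(∂Ω)`, complex-valued. -/
abbrev L2Bdry {d : ℕ} (Ω : Set (Eucl d)) : Type := Lp ℂ 2 (surfaceMeasure Ω)

/-- The `i`-th partial derivative. -/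
noncomputable def partialDeriv {d : ℕ} {F : Type*} [NormedAddCommGroup F] [NormedSpace ℝ F]
    (i : Fin d) (φ : Eucl d → F) (x : Eucl d) : F :=
  fderiv ℝ φ x (EuclideanSpace.single i 1)

/-- The classical gradient of a complex-valued function. -/
noncomputable def classicalGradient {d : ℕ} (φ : Eucl d → ℂ) (x : Eucl d) :
    EuclideanSpace ℂ (Fin d) :=
  WithLp.toLp 2 fun i => partialDeriv i φ x

/-- `G` is the weak gradient of `f` in `Ω`. -/
def IsWeakGradient {d : ℕ} (Ω : Set (Eucl d)) (f : L2 Ω) (G : L2Vec Ω) : Prop :=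
  ∀ φ : Eucl d → ℝ, ContDiff ℝ ∞ φ → HasCompactSupport φ → tsupport φ ⊆ Ω →
    ∀ i, ∫ x in Ω, partialDeriv i φ x • f x = -∫ x in Ω, φ x • G x i

theorem integrable_smul_of_test {d : ℕ} {F : Type*} [NormedAddCommGroup F] [NormedSpace ℝ F]
    {μ : Measure (Eucl d)} [IsLocallyFiniteMeasure μ] {f : Eucl d → F} (hf : MemLp f 2 μ)
    {φ : Eucl d → ℝ} (hφ : Continuous φ) (hc : HasCompactSupport φ) :
    Integrable (fun x => φ x • f x) μ :=
  (hf.locallyIntegrable one_le_two).integrable_smul_left_of_hasCompactSupport hφ hc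

theorem continuous_partialDeriv {d : ℕ} {φ : Eucl d → ℝ} (h : ContDiff ℝ ∞ φ) (i : Fin d) :
    Continuous (partialDeriv i φ) :=
  (h.continuous_fderiv (by simp)).clm_apply continuous_const

theorem hasCompactSupport_partialDeriv {d : ℕ} {φ : Eucl d → ℝ} (h : HasCompactSupport φ)
    (i : Fin d) : HasCompactSupport (partialDeriv i φ) :=
  h.fderiv_apply ℝ _

theorem memLp_coord {d : ℕ} {Ω : Set (Eucl d)} (G : L2Vec Ω) (i : Fin d) :
    MemLp (fun x => G x i) 2 (volume.restrict Ω) :=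
  (EuclideanSpace.proj (𝕜 := ℂ) i).comp_memLp G

theorem IsWeakGradient.add {d : ℕ} {Ω : Set (Eucl d)} {f g : L2 Ω} {G K : L2Vec Ω}
    (hf : IsWeakGradient Ω f G) (hg : IsWeakGradient Ω g K) : IsWeakGradient Ω (f + g) (G + K) := by
  intro φ h1 h2 h3 i
  have e1 : ∫ x in Ω, partialDeriv i φ x • (f + g : L2 Ω) x
      = ∫ x in Ω, (partialDeriv i φ x • f x + partialDeriv i φ x • g x) := by
    refine integral_congr_ae ?_
    filter_upwards [Lp.coeFn_add f g] with x hx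
    rw [hx, Pi.add_apply, smul_add]
  have e2 : ∫ x in Ω, φ x • (G + K : L2Vec Ω) x i = ∫ x in Ω, (φ x • G x i + φ x • K x i) := by
    refine integral_congr_ae ?_
    filter_upwards [Lp.coeFn_add G K] with x hx
    rw [hx, Pi.add_apply, PiLp.add_apply, smul_add]
  have c1 := continuous_partialDeriv h1 i
  have c2 := hasCompactSupport_partialDeriv h2 i
  rw [e1, e2, integral_add (integrable_smul_of_test (Lp.memLp f) c1 c2)
      (integrable_smul_of_test (Lp.memLp g) c1 c2),
    integral_add (integrable_smul_of_test (memLp_coord G i) h1.continuous h2)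
      (integrable_smul_of_test (memLp_coord K i) h1.continuous h2),
    hf φ h1 h2 h3 i, hg φ h1 h2 h3 i, neg_add]

theorem IsWeakGradient.smul {d : ℕ} {Ω : Set (Eucl d)} {f : L2 Ω} {G : L2Vec Ω} (c : ℂ)
    (hf : IsWeakGradient Ω f G) : IsWeakGradient Ω (c • f) (c • G) := by
  intro φ h1 h2 h3 i
  have e1 : ∫ x in Ω, partialDeriv i φ x • (c • f : L2 Ω) x
      = ∫ x in Ω, c • (partialDeriv i φ x • f x) := by
    refine integral_congr_ae ?_
    filter_upwards [Lp.coeFn_smul c f] with x hx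
    rw [hx, Pi.smul_apply, smul_comm]
  have e2 : ∫ x in Ω, φ x • (c • G : L2Vec Ω) x i = ∫ x in Ω, c • (φ x • G x i) := by
    refine integral_congr_ae ?_
    filter_upwards [Lp.coeFn_smul c G] with x hx
    rw [hx, Pi.smul_apply, PiLp.smul_apply, smul_comm]
  rw [e1, e2, integral_smul, integral_smul, hf φ h1 h2 h3 i, smul_neg]

theorem isWeakGradient_zero {d : ℕ} (Ω : Set (Eucl d)) : IsWeakGradient Ω 0 0 := by
  intro φ _ _ _ i
  have e1 : ∫ x in Ω, partialDeriv i φ x • (0 : L2 Ω) x = 0 := by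
    refine integral_eq_zero_of_ae ?_
    filter_upwards [Lp.coeFn_zero ℂ 2 (volume.restrict Ω)] with x hx
    rw [hx]
    exact smul_zero _
  have e2 : ∫ x in Ω, φ x • (0 : L2Vec Ω) x i = 0 := by
    refine integral_eq_zero_of_ae ?_
    filter_upwards [Lp.coeFn_zero (EuclideanSpace ℂ (Fin d)) 2 (volume.restrict Ω)] with x hx
    rw [hx]
    exact smul_zero _
  rw [e1, e2, neg_zero]

/-- The weak gradient, as an unbounded operator from `L²(Ω)` to `L²(Ω; ℂᵈ)`; its domain consists of
all `f` in `L²(Ω)` whose weak gradient exists and lies in `L²(Ω; ℂᵈ)`. -/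
noncomputable def weakGradient {d : ℕ} (Ω : Set (Eucl d)) : L2 Ω →ₗ.[ℂ] L2Vec Ω :=
  Submodule.toLinearPMap
    { carrier := {p | IsWeakGradient Ω p.1 p.2}
      add_mem' := fun hp hq => hp.add hq
      zero_mem' := isWeakGradient_zero Ω
      smul_mem' := fun c _ hp => hp.smul c }

/-- The Sobolev space `H¹(Ω)`. -/
noncomputable def H1 {d : ℕ} (Ω : Set (Eucl d)) : Submodule ℂ (L2 Ω) := (weakGradient Ω).domain

/-- The gradient `∇f` of `f` in `H¹(Ω)`. -/
noncomputable def grad {d : ℕ} (Ω : Set (Eucl d)) : H1 Ω →ₗ[ℂ] L2Vec Ω := (weakGradient Ω).toFun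

/-! ### The trace -/

/-- `g` in `L²(∂Ω)` is the trace of `f` in `H¹(Ω)`: there are smooth compactly supported functions
`φ k` on the whole space whose restrictions to `Ω` converge to `f` in `H¹(Ω)` and whose restrictions
to `∂Ω` converge to `g` in `L²(∂Ω)`. -/
def IsTrace {d : ℕ} (Ω : Set (Eucl d)) (f : H1 Ω) (g : L2Bdry Ω) : Prop :=
  ∃ φ : ℕ → Eucl d → ℂ, (∀ k, ContDiff ℝ ∞ (φ k) ∧ HasCompactSupport (φ k)) ∧
    Tendsto (fun k => eLpNorm (fun x => φ k x - (f : L2 Ω) x) 2 (volume.restrict Ω))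
      atTop (𝓝 0) ∧
    Tendsto (fun k => eLpNorm (fun x => classicalGradient (φ k) x - grad Ω f x) 2
      (volume.restrict Ω)) atTop (𝓝 0) ∧
    Tendsto (fun k => eLpNorm (fun x => φ k x - g x) 2 (surfaceMeasure Ω)) atTop (𝓝 0)

open Classical in
/-- The trace map `f ↦ f|_∂Ω` from `H¹(Ω)` to `L²(∂Ω)`. -/
noncomputable def trace {d : ℕ} (Ω : Set (Eucl d)) : H1 Ω →ₗ[ℂ] L2Bdry Ω :=
  if h : ∃ T : H1 Ω →ₗ[ℂ] L2Bdry Ω, ∀ f, IsTrace Ω f (T f) then h.choose else 0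

/-! ### The Robin form and the Robin Laplacian -/

/-- The form `t_β[f, g] = (∇f, ∇g) - β (f|_∂Ω, g|_∂Ω)` on `H¹(Ω)`, linear in `f` and conjugate
linear in `g` (the inner products of Mathlib are conjugate linear in the first variable). -/
noncomputable def robinForm {d : ℕ} (Ω : Set (Eucl d)) (β : ℝ) (f g : H1 Ω) : ℂ :=
  inner ℂ (grad Ω g) (grad Ω f) - (β : ℂ) * inner ℂ (trace Ω g) (trace Ω f)

/-- The Robin Laplacian `-Δ_β`, the operator in `L²(Ω)` that the form `t_β` induces by the first
representation theorem: its domain consists of those `f` in `H¹(Ω)` for which there is an `h` in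
`L²(Ω)` with `t_β[f, v] = (h, v)` for all `v` in `H¹(Ω)`, and it maps `f` to `h`. -/
noncomputable def robinLaplacian {d : ℕ} (Ω : Set (Eucl d)) (β : ℝ) : L2 Ω →ₗ.[ℂ] L2 Ω :=
  Submodule.toLinearPMap
    { carrier := {p | ∃ f : H1 Ω, (f : L2 Ω) = p.1 ∧
        ∀ v : H1 Ω, robinForm Ω β f v = inner ℂ (v : L2 Ω) p.2}
      add_mem' := by
        rintro p q ⟨f, hf, hfv⟩ ⟨g, hg, hgv⟩
        refine ⟨f + g, by simp [hf, hg], fun v => ?_⟩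
        rw [Prod.snd_add, inner_add_right, ← hfv v, ← hgv v]
        simp only [robinForm, map_add, inner_add_right]
        ring
      zero_mem' := ⟨0, by simp, fun v => by simp [robinForm]⟩
      smul_mem' := by
        rintro c p ⟨f, hf, hfv⟩
        refine ⟨c • f, by simp [hf], fun v => ?_⟩
        rw [Prod.smul_snd, inner_smul_right, ← hfv v]
        simp only [robinForm, map_smul, inner_smul_right]
        ring }

/-- The resolvent set of an unbounded operator: all `z` for which `A - z` maps the domain of `A`
bijectively onto the whole space and has a bounded inverse. -/
def resolventSetPMap {H : Type*} [NormedAddCommGroup H] [NormedSpace ℂ H] (A : H →ₗ.[ℂ] H) :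
    Set ℂ :=
  {z | ∃ R : H →L[ℂ] H,
    (∀ h : H, ∃ hd : R h ∈ A.domain, A ⟨R h, hd⟩ - z • R h = h) ∧
    (∀ f : A.domain, R (A f - z • (f : H)) = f)}

/-- The spectrum of an unbounded operator. -/
def spectrumPMap {H : Type*} [NormedAddCommGroup H] [NormedSpace ℂ H] (A : H →ₗ.[ℂ] H) : Set ℂ :=
  (resolventSetPMap A)ᶜ

/-- `F_Ω(β)`, the infimum of the spectrum of the Robin Laplacian. -/
noncomputable def bottom {d : ℕ} (Ω : Set (Eucl d)) (β : ℝ) : ℝ :=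
  sInf {t : ℝ | (t : ℂ) ∈ spectrumPMap (robinLaplacian Ω β)}

end RobinLaplacian

namespace RobinLaplacian

/-! ### Infima of families of affine functions -/

section InfAffine

variable {ι : Type*} {a b : ι → ℝ}

/-! For a unit vector `f` of H¹(Ω) the form is the affine function β ↦ a − βb with a = ‖∇f‖² and b =
‖f|∂Ω‖², both nonnegative. If F is the infimum of the form over unit vectors, then F is an infimum
of non-increasing affine functions, so it is non-increasing and concave. Concavity on all of ℝ gives
continuity, F(0) ≥ 0 is clear, and one `f` with nonzero trace forces F → −∞. Strict decrease below
zero is a scaling argument (`iInf_sub_mul_lt`), and the root of F = −1 comes from the intermediate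
value theorem and this strictness.

Everything rests on the trace inequality b ≤ εa + C_ε, which makes F finite. For smooth functions it
follows by integrating along short vertical segments that start on the boundary in each Lipschitz
chart; the uniform ε, N, M make the sum over charts finite (`exists_trace_bound`). To carry it over
to H¹(Ω), smooth compactly supported functions must be dense: cut off, localise by a partition of
unity, and mollify with a kernel shifted along an interior cone (`approximable`). The trace is then
the limit on the boundary, and the inequality passes to the closure. It is not identically zero
because the boundary has positive surface measure near each of its points.

On the operator side, closedness of the weak gradient makes H¹(Ω) a Hilbert space, and a Lax–Milgram
argument places every non-real z and every real z below the form bound in the resolvent set. The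
bound itself is in the spectrum: near-minimisers and Cauchy–Schwarz for the shifted form contradict
a bounded resolvent (`ofReal_mem_spectrumPMap`). Hence the infimum of the form is the least point of
the spectrum. -/

theorem bddBelow_range_sub_mul (ha : ∀ i, 0 ≤ a i) (hb : ∀ i, 0 ≤ b i)
    (hab : ∀ ε > 0, ∃ C, ∀ i, b i ≤ ε * a i + C) (β : ℝ) :
    BddBelow (Set.range fun i => a i - β * b i) := by
  -- With this ε one has |β|ε ≤ 1, so `a i` absorbs the part of |β|`b i` that is proportional to it.
  obtain ⟨C, hC⟩ := hab (1 / (|β| + 1)) (by positivity)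
  refine ⟨-(|β| * |C|), ?_⟩
  rintro _ ⟨i, rfl⟩
  have h1 : β * b i ≤ |β| * b i := mul_le_mul_of_nonneg_right (le_abs_self β) (hb i)
  have h2 : |β| * b i ≤ |β| * (1 / (|β| + 1) * a i + C) :=
    mul_le_mul_of_nonneg_left (hC i) (abs_nonneg β)
  have h3 : |β| * (1 / (|β| + 1)) ≤ 1 := by
    rw [mul_one_div, div_le_one (by positivity)]
    linarith
  have h4 : |β| * C ≤ |β| * |C| := mul_le_mul_of_nonneg_left (le_abs_self C) (abs_nonneg β)
  have h5 : |β| * (1 / (|β| + 1)) * a i ≤ 1 * a i := mul_le_mul_of_nonneg_right h3 (ha i)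
  simp only
  nlinarith

theorem antitone_iInf_sub_mul (ha : ∀ i, 0 ≤ a i) (hb : ∀ i, 0 ≤ b i)
    (hab : ∀ ε > 0, ∃ C, ∀ i, b i ≤ ε * a i + C) :
    Antitone fun β : ℝ => ⨅ i, (a i - β * b i) := by
  intro β γ h
  refine ciInf_mono (bddBelow_range_sub_mul ha hb hab γ) fun i => ?_
  have := mul_le_mul_of_nonneg_right h (hb i)
  linarith

/-- The infimum need not be attained, so strictness needs a margin. Since m < 0, the level mβ/γ lies
strictly above m, so some i has a − βb below it. Then a − γb = (γ/β)(a − βb) − (γ/β − 1)a is less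
than m, because a ≥ 0. For β = 0 the infimum cannot be negative. -/
theorem iInf_sub_mul_lt [Nonempty ι] (ha : ∀ i, 0 ≤ a i) (hb : ∀ i, 0 ≤ b i)
    (hab : ∀ ε > 0, ∃ C, ∀ i, b i ≤ ε * a i + C) {β γ : ℝ} (hβ : 0 ≤ β)
    (hneg : ⨅ i, (a i - β * b i) < 0) (h : β < γ) :
    ⨅ i, (a i - γ * b i) < ⨅ i, (a i - β * b i) := by
  set m := ⨅ i, (a i - β * b i) with hm
  have hγ : 0 < γ := hβ.trans_lt h
  obtain ⟨i, hi⟩ := exists_lt_of_ciInf_lt (show ⨅ i, (a i - β * b i) < m * (β / γ) by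
    rw [← hm]
    have : β / γ < 1 := (div_lt_one hγ).2 h
    nlinarith)
  refine (ciInf_le (bddBelow_range_sub_mul ha hb hab γ) i).trans_lt ?_
  rcases hβ.eq_or_lt with rfl | hβ
  · have := ha i
    simp only [zero_mul, sub_zero, zero_div, mul_zero] at hi
    linarith
  have h1 : a i - γ * b i = γ / β * (a i - β * b i) - (γ / β - 1) * a i := by
    field_simp
    ring
  have h2 : 1 < γ / β := (one_lt_div hβ).2 h
  have h3 : γ / β * (m * (β / γ)) = m := by field_simp
  have h4 := mul_lt_mul_of_pos_left hi (by positivity : 0 < γ / β)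
  have h5 := mul_nonneg (sub_nonneg.2 h2.le) (ha i)
  linarith

/-- A finite infimum of affine functions is concave, and a concave function on an open subset of ℝ
is continuous. Working on all of ℝ, negative β included, gives continuity at 0 without separate
treatment. -/
theorem continuous_iInf_sub_mul [Nonempty ι] (ha : ∀ i, 0 ≤ a i) (hb : ∀ i, 0 ≤ b i)
    (hab : ∀ ε > 0, ∃ C, ∀ i, b i ≤ ε * a i + C) :
    Continuous fun β : ℝ => ⨅ i, (a i - β * b i) := by
  rw [← continuousOn_univ]
  refine ConcaveOn.continuousOn isOpen_univ ⟨convex_univ, fun x _ y _ s t hs ht hst => ?_⟩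
  refine le_ciInf fun i => ?_
  have h1 := ciInf_le (bddBelow_range_sub_mul ha hb hab x) i
  have h2 := ciInf_le (bddBelow_range_sub_mul ha hb hab y) i
  have h3 := mul_le_mul_of_nonneg_left h1 hs
  have h4 := mul_le_mul_of_nonneg_left h2 ht
  have h5 : a i = s * a i + t * a i := by rw [← add_mul, hst, one_mul]
  simp only [smul_eq_mul]
  linarith

theorem tendsto_iInf_sub_mul (ha : ∀ i, 0 ≤ a i) (hb : ∀ i, 0 ≤ b i)
    (hab : ∀ ε > 0, ∃ C, ∀ i, b i ≤ ε * a i + C) {i : ι} (hi : 0 < b i) :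
    Tendsto (fun β : ℝ => ⨅ i, (a i - β * b i)) atTop atBot := by
  refine tendsto_atBot_mono (fun β => ciInf_le (bddBelow_range_sub_mul ha hb hab β) i) ?_
  simp only [sub_eq_add_neg]
  refine tendsto_atBot_add_const_left _ _ ?_
  exact tendsto_neg_atTop_atBot.comp (tendsto_id.atTop_mul_const hi)

end InfAffine

/-! ### Semibounded forms and the first representation theorem -/

section Form

variable {H K B : Type*} [NormedAddCommGroup H] [InnerProductSpace ℂ H]
  [NormedAddCommGroup K] [InnerProductSpace ℂ K]
  [NormedAddCommGroup B] [InnerProductSpace ℂ B]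
  {V : Submodule ℂ H} (D : V →ₗ[ℂ] K) (T : V →ₗ[ℂ] B)

/-- The form `(Df, Dg) - β (Tf, Tg)`, linear in `f` and conjugate linear in `g`. -/
noncomputable def energyForm (β : ℝ) (f g : V) : ℂ :=
  inner ℂ (D g) (D f) - (β : ℂ) * inner ℂ (T g) (T f)

theorem energyForm_self (β : ℝ) (f : V) :
    energyForm D T β f f = ((‖D f‖ ^ 2 - β * ‖T f‖ ^ 2 : ℝ) : ℂ) := by
  simp [energyForm, inner_self_eq_norm_sq_to_K]

theorem energyForm_conj (β : ℝ) (f g : V) :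
    (starRingEnd ℂ) (energyForm D T β f g) = energyForm D T β g f := by
  simp [energyForm, inner_conj_symm]

/-- The embedding of the form domain into the product `H × K` with its Hilbert norm. -/
noncomputable def graphEmbedding : V →ₗ[ℂ] WithLp 2 (H × K) :=
  (WithLp.linearEquiv 2 ℂ (H × K)).symm.toLinearMap ∘ₗ V.subtype.prod D

theorem norm_graphEmbedding_sq (f : V) :
    ‖graphEmbedding D f‖ ^ 2 = ‖f‖ ^ 2 + ‖D f‖ ^ 2 := by
  rw [WithLp.prod_norm_sq_eq_of_L2]
  rfl

theorem graphEmbedding_injective : Function.Injective (graphEmbedding D) := fun _ _ h =>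
  Subtype.ext (congrArg WithLp.fst h)

/-- Replaces `V` by its image in `H × K`, whose norm is the graph norm, so that maps bounded in the
graph norm become continuous maps with adjoints once the range is complete. -/
theorem exists_continuousLinearMap_range_graphEmbedding {F : Type*} [NormedAddCommGroup F]
    [InnerProductSpace ℂ F] (S : V →ₗ[ℂ] F)
    (hS : ∃ C, ∀ f, ‖S f‖ ^ 2 ≤ C * (‖f‖ ^ 2 + ‖D f‖ ^ 2)) :
    ∃ S' : LinearMap.range (graphEmbedding D) →L[ℂ] F,
      ∀ f, S' (LinearEquiv.ofInjective (graphEmbedding D) (graphEmbedding_injective D) f) =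
        S f := by
  obtain ⟨C, hC⟩ := hS
  set E := LinearEquiv.ofInjective (graphEmbedding D) (graphEmbedding_injective D)
  refine ⟨LinearMap.mkContinuousOfExistsBound (S ∘ₗ E.symm.toLinearMap) ⟨√|C|, fun w => ?_⟩,
    fun f => by simp⟩
  obtain ⟨f, rfl⟩ := E.surjective w
  simp only [LinearMap.comp_apply, LinearEquiv.coe_coe, LinearEquiv.symm_apply_apply]
  refine abs_le_of_sq_le_sq' ?_ (by positivity) |>.2
  have hE : ‖E f‖ ^ 2 = ‖f‖ ^ 2 + ‖D f‖ ^ 2 := norm_graphEmbedding_sq D f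
  rw [mul_pow, Real.sq_sqrt (abs_nonneg C), hE]
  exact (hC f).trans (mul_le_mul_of_nonneg_right (le_abs_self C) (by positivity))

variable [CompleteSpace H] [CompleteSpace K] [CompleteSpace B]

/-- Lax–Milgram. On the complete graph space W the shifted form is represented by Λ = G*G − βS*S −
zJ*J, where G, S, J are `D`, `T` and the inclusion into `H`. Coercivity makes Λ invertible, and J*h
is the Riesz representative of h restricted to W, so the solution operator is JΛ⁻¹J*. -/
theorem exists_boundedOperator_of_coercive
    (hD : IsClosed {p : H × K | ∃ f : V, (f : H) = p.1 ∧ D f = p.2})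
    (hT : ∃ C, ∀ f, ‖T f‖ ^ 2 ≤ ‖D f‖ ^ 2 + C * ‖f‖ ^ 2) (β : ℝ) (z : ℂ) {c : ℝ} (hc : 0 < c)
    (hco : ∀ f : V, c * (‖f‖ ^ 2 + ‖D f‖ ^ 2) ≤ ‖energyForm D T β f f - z * ‖f‖ ^ 2‖) :
    ∃ R : H →L[ℂ] V, ∀ h : H,
      (∀ v : V, energyForm D T β (R h) v - z * inner ℂ (v : H) (R h : H) = inner ℂ (v : H) h) ∧
      ∀ f : V, (∀ v : V, energyForm D T β f v - z * inner ℂ (v : H) (f : H) = inner ℂ (v : H) h) →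
        R h = f := by
  set W : Submodule ℂ (WithLp 2 (H × K)) := LinearMap.range (graphEmbedding D) with hW
  have hWc : IsClosed (W : Set (WithLp 2 (H × K))) := by
    have : (W : Set (WithLp 2 (H × K))) =
        (WithLp.prodContinuousLinearEquiv 2 ℂ H K) ⁻¹'
          {p : H × K | ∃ f : V, (f : H) = p.1 ∧ D f = p.2} := by
      ext p
      constructor
      · rintro ⟨f, rfl⟩
        exact ⟨f, rfl, rfl⟩
      · rintro ⟨f, h1, h2⟩
        refine ⟨f, ?_⟩
        apply (WithLp.prodContinuousLinearEquiv 2 ℂ H K).injective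
        exact Prod.ext h1 h2
    rw [this]
    exact hD.preimage (WithLp.prodContinuousLinearEquiv 2 ℂ H K).continuous
  have : CompleteSpace W := hWc.completeSpace_coe
  let E : V ≃ₗ[ℂ] W := LinearEquiv.ofInjective (graphEmbedding D) (graphEmbedding_injective D)
  have hEn : ∀ f, ‖E f‖ ^ 2 = ‖f‖ ^ 2 + ‖D f‖ ^ 2 := fun f => norm_graphEmbedding_sq D f
  obtain ⟨J, hJ⟩ : ∃ J : W →L[ℂ] H, ∀ f, J (E f) = V.subtype f :=
    exists_continuousLinearMap_range_graphEmbedding D V.subtype ⟨1, fun f => by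
    have := sq_nonneg ‖D f‖
    rw [Submodule.subtype_apply, Submodule.coe_norm]
    linarith⟩
  obtain ⟨G, hG⟩ : ∃ G : W →L[ℂ] K, ∀ f, G (E f) = D f :=
    exists_continuousLinearMap_range_graphEmbedding D D ⟨1, fun f => by
    have := sq_nonneg ‖f‖
    linarith⟩
  obtain ⟨S, hS⟩ : ∃ S : W →L[ℂ] B, ∀ f, S (E f) = T f :=
    exists_continuousLinearMap_range_graphEmbedding D T (by
    obtain ⟨C, hC⟩ := hT
    refine ⟨1 + |C|, fun f => (hC f).trans ?_⟩
    have h1 := mul_nonneg (abs_nonneg C) (sq_nonneg ‖D f‖)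
    have h2 := mul_le_mul_of_nonneg_right (le_abs_self C) (sq_nonneg ‖f‖)
    have h3 := sq_nonneg ‖f‖
    linarith)
  let Λ : W →L[ℂ] W := G.adjoint ∘L G - (β : ℂ) • (S.adjoint ∘L S) - z • (J.adjoint ∘L J)
  have hΛ : ∀ f v : V, inner ℂ (E v) (Λ (E f)) =
      energyForm D T β f v - z * inner ℂ (v : H) (f : H) := by
    intro f v
    have hsm : ∀ (c : ℂ) (x y : W), inner ℂ x (c • y) = c * inner ℂ x y := fun c x y =>
      inner_smul_right x y c
    simp only [Λ, _root_.sub_apply, _root_.smul_apply,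
      ContinuousLinearMap.comp_apply, inner_sub_right, hsm,
      ContinuousLinearMap.adjoint_inner_right, hG, hS, hJ, energyForm, Submodule.subtype_apply]
  have hU : IsUnit Λ := by
    refine ContinuousLinearMap.isUnit_of_forall_le_norm_inner_map Λ (c := ⟨c, hc.le⟩) hc
      fun w => ?_
    obtain ⟨f, rfl⟩ := E.surjective w
    rw [← inner_conj_symm, RCLike.norm_conj, hΛ, hEn, inner_self_eq_norm_sq_to_K, mul_comm]
    exact hco f
  obtain ⟨u, hu⟩ := hU
  let Λi : W →L[ℂ] W := ((u⁻¹ : (W →L[ℂ] W)ˣ) : W →L[ℂ] W)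
  have hΛi : ∀ w, Λ (Λi w) = w := fun w => by
    have : (u : W →L[ℂ] W) * Λi = 1 := u.mul_inv
    rw [← hu]
    exact congrArg (fun L : W →L[ℂ] W => L w) this
  have hiΛ : ∀ w, Λi (Λ w) = w := fun w => by
    have : Λi * (u : W →L[ℂ] W) = 1 := u.inv_mul
    rw [← hu]
    exact congrArg (fun L : W →L[ℂ] W => L w) this
  have hcod : ∀ w, J w ∈ V := fun w => by
    obtain ⟨f, rfl⟩ := E.surjective w
    rw [hJ]
    exact f.2
  have hcodE : ∀ f, J.codRestrict V hcod (E f) = f := fun f => Subtype.ext (hJ f)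
  refine ⟨(J.codRestrict V hcod) ∘L Λi ∘L J.adjoint, fun h => ⟨fun v => ?_, fun f hf => ?_⟩⟩
  · obtain ⟨f, hf⟩ := E.surjective (Λi (J.adjoint h))
    rw [ContinuousLinearMap.comp_apply, ContinuousLinearMap.comp_apply, ← hf, hcodE, ← hΛ, hf,
      hΛi, ContinuousLinearMap.adjoint_inner_right, hJ, Submodule.subtype_apply]
  · have : Λ (E f) = J.adjoint h := by
      refine ext_inner_left ℂ fun w => ?_
      obtain ⟨v, rfl⟩ := E.surjective w
      rw [hΛ, hf, ContinuousLinearMap.adjoint_inner_right, hJ, Submodule.subtype_apply]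
    rw [ContinuousLinearMap.comp_apply, ContinuousLinearMap.comp_apply, ← this, hiΛ, hcodE]

variable {D T} {β : ℝ} {A : H →ₗ.[ℂ] H}

/-- Coercivity in the norm of `H` alone suffices: the trace bound controls ‖Df‖² by the shifted form
plus a multiple of ‖f‖², and the hypothesis controls ‖f‖². Together they give coercivity in the
graph norm, and Lax–Milgram yields the resolvent. -/
theorem mem_resolventSetPMap_of_le
    (hD : IsClosed {p : H × K | ∃ f : V, (f : H) = p.1 ∧ D f = p.2})
    (hT : ∀ ε > 0, ∃ C, ∀ f, ‖T f‖ ^ 2 ≤ ε * ‖D f‖ ^ 2 + C * ‖f‖ ^ 2)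
    (hA : ∀ p : H × H, p ∈ A.graph ↔
      ∃ f : V, (f : H) = p.1 ∧ ∀ v : V, energyForm D T β f v = inner ℂ (v : H) p.2)
    {z : ℂ} {c : ℝ} (hc : 0 < c)
    (hco : ∀ f : V, c * ‖f‖ ^ 2 ≤ ‖energyForm D T β f f - z * ‖f‖ ^ 2‖) :
    z ∈ resolventSetPMap A := by
  have hlow : ∃ C, 0 ≤ C ∧ ∀ f : V,
      ‖D f‖ ^ 2 / 2 - C * ‖f‖ ^ 2 ≤ ‖energyForm D T β f f - z * ‖f‖ ^ 2‖ := by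
    -- This ε lets the boundary term use up at most half of ‖Df‖².
    obtain ⟨C, hC⟩ := hT (1 / (2 * (|β| + 1))) (by positivity)
    refine ⟨|β| * |C| + ‖z‖, by positivity, fun f => ?_⟩
    have h1 : ‖D f‖ ^ 2 - β * ‖T f‖ ^ 2 - ‖z‖ * ‖f‖ ^ 2 ≤
        ‖energyForm D T β f f - z * ‖f‖ ^ 2‖ := by
      refine le_trans ?_ (norm_sub_norm_le _ _)
      rw [energyForm_self, norm_mul, norm_pow, Complex.norm_real, Complex.norm_real, norm_norm]
      exact sub_le_sub_right (le_abs_self _) _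
    have h2 : β * ‖T f‖ ^ 2 ≤ |β| * ‖T f‖ ^ 2 :=
      mul_le_mul_of_nonneg_right (le_abs_self β) (sq_nonneg _)
    have h3 := mul_le_mul_of_nonneg_left (hC f) (abs_nonneg β)
    have h4 : |β| * (1 / (2 * (|β| + 1))) ≤ 1 / 2 := by
      rw [mul_one_div, div_le_div_iff₀ (by positivity) (by positivity)]
      linarith
    have h5 := mul_le_mul_of_nonneg_right h4 (sq_nonneg ‖D f‖)
    have h6 := mul_le_mul_of_nonneg_right (le_abs_self C) (sq_nonneg ‖f‖)
    have h7 := mul_le_mul_of_nonneg_left h6 (abs_nonneg β)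
    nlinarith
  obtain ⟨C, hC0, hC⟩ := hlow
  -- Adding (C + 1)/c times `hco` to `hC` turns −C‖f‖² into +‖f‖², leaving ‖Df‖²/2 + ‖f‖², which is
  -- at least half of the squared graph norm.
  have hco' : ∀ f : V, (2 * (1 + (C + 1) / c))⁻¹ * (‖f‖ ^ 2 + ‖D f‖ ^ 2) ≤
      ‖energyForm D T β f f - z * ‖f‖ ^ 2‖ := by
    intro f
    rw [inv_mul_le_iff₀ (by positivity)]
    have h1 := hco f
    have h2 := hC f
    have h3 := mul_le_mul_of_nonneg_left h1 (by positivity : 0 ≤ (C + 1) / c)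
    have h4 : (C + 1) / c * (c * ‖f‖ ^ 2) = (C + 1) * ‖f‖ ^ 2 := by field_simp
    have h5 := sq_nonneg ‖f‖
    nlinarith
  obtain ⟨R, hR⟩ := exists_boundedOperator_of_coercive D T hD
    (by simpa using hT 1 one_pos) β z (by positivity) hco'
  refine ⟨V.subtypeL ∘L R, fun h => ?_, fun f => ?_⟩
  · have hg : ((R h : H), h + z • (R h : H)) ∈ A.graph := by
      refine (hA _).2 ⟨R h, rfl, fun v => ?_⟩
      rw [inner_add_right, inner_smul_right, ← (hR h).1 v]
      ring
    obtain ⟨y, hy1, hy2⟩ := (LinearPMap.mem_graph_iff A).1 hg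
    simp only at hy1 hy2
    have hd : (R h : H) ∈ A.domain := hy1 ▸ y.2
    refine ⟨hd, ?_⟩
    have : y = ⟨(R h : H), hd⟩ := Subtype.ext hy1
    rw [this] at hy2
    change A ⟨(R h : H), hd⟩ - z • (R h : H) = h
    rw [hy2, add_sub_cancel_right]
  · obtain ⟨g, hg1, hg2⟩ := (hA ((f : H), A f)).1 (A.mem_graph f)
    simp only at hg1 hg2
    have := (hR (A f - z • (f : H))).2 g fun v => by
      rw [hg2, hg1, inner_sub_right, inner_smul_right]
    rw [ContinuousLinearMap.comp_apply, this]
    exact hg1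

/-- The form is real on the diagonal, so the imaginary part of its shift by z already has size |Im
z|‖f‖². -/
theorem im_eq_zero_of_mem_spectrumPMap
    (hD : IsClosed {p : H × K | ∃ f : V, (f : H) = p.1 ∧ D f = p.2})
    (hT : ∀ ε > 0, ∃ C, ∀ f, ‖T f‖ ^ 2 ≤ ε * ‖D f‖ ^ 2 + C * ‖f‖ ^ 2)
    (hA : ∀ p : H × H, p ∈ A.graph ↔
      ∃ f : V, (f : H) = p.1 ∧ ∀ v : V, energyForm D T β f v = inner ℂ (v : H) p.2)
    {z : ℂ} (hz : z ∈ spectrumPMap A) : z.im = 0 := by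
  by_contra h
  refine hz (mem_resolventSetPMap_of_le hD hT hA (abs_pos.2 h) fun f => ?_)
  refine le_trans (le_of_eq ?_) (Complex.abs_im_le_norm _)
  rw [energyForm_self, ← Complex.ofReal_pow, Complex.sub_im, Complex.ofReal_im,
    Complex.im_mul_ofReal, zero_sub, abs_neg, abs_mul, abs_of_nonneg (sq_nonneg ‖f‖)]

theorem le_of_mem_spectrumPMap
    (hD : IsClosed {p : H × K | ∃ f : V, (f : H) = p.1 ∧ D f = p.2})
    (hT : ∀ ε > 0, ∃ C, ∀ f, ‖T f‖ ^ 2 ≤ ε * ‖D f‖ ^ 2 + C * ‖f‖ ^ 2)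
    (hA : ∀ p : H × H, p ∈ A.graph ↔
      ∃ f : V, (f : H) = p.1 ∧ ∀ v : V, energyForm D T β f v = inner ℂ (v : H) p.2)
    {m : ℝ} (hm : ∀ f : V, m * ‖f‖ ^ 2 ≤ ‖D f‖ ^ 2 - β * ‖T f‖ ^ 2)
    {t : ℝ} (ht : (t : ℂ) ∈ spectrumPMap A) : m ≤ t := by
  by_contra! h
  refine ht (mem_resolventSetPMap_of_le hD hT hA (sub_pos.2 h) fun f => ?_)
  rw [energyForm_self, ← Complex.ofReal_pow, ← Complex.ofReal_mul, ← Complex.ofReal_sub,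
    Complex.norm_real]
  refine le_trans ?_ (le_abs_self _)
  have := hm f
  linarith

omit [CompleteSpace H] [CompleteSpace K] [CompleteSpace B] in
-- Cauchy–Schwarz for the form shifted by its lower bound. That form is only positive semidefinite,
-- hence `PreInnerProductSpace.Core`.
theorem norm_energyForm_sub_sq_le {m : ℝ}
    (hm : ∀ f : V, m * ‖f‖ ^ 2 ≤ ‖D f‖ ^ 2 - β * ‖T f‖ ^ 2) (f g : V) :
    ‖energyForm D T β f g - m * inner ℂ (g : H) (f : H)‖ ^ 2 ≤
      (‖D f‖ ^ 2 - β * ‖T f‖ ^ 2 - m * ‖f‖ ^ 2) * (‖D g‖ ^ 2 - β * ‖T g‖ ^ 2 - m * ‖g‖ ^ 2) := by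
  let core : PreInnerProductSpace.Core ℂ V :=
    { inner := fun g f => energyForm D T β f g - m * inner ℂ (g : H) (f : H)
      conj_inner_symm := fun _ _ => by
        simp [map_sub, energyForm_conj, inner_conj_symm]
      re_inner_nonneg := fun f => by
        have := hm f
        rw [energyForm_self, inner_self_eq_norm_sq_to_K]
        norm_cast
        simp only [Complex.coe_algebraMap, RCLike.re_to_complex]
        norm_cast
        linarith
      add_left := fun f g h => by
        simp only [energyForm, map_add, inner_add_left, Submodule.coe_add]
        ring
      smul_left := fun f g c => by
        simp only [energyForm, map_smul, inner_smul_left, Submodule.coe_smul]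
        ring }
  have hself : ∀ f : V, (core.inner f f) = ((‖D f‖ ^ 2 - β * ‖T f‖ ^ 2 - m * ‖f‖ ^ 2 : ℝ) : ℂ) := by
    intro f
    change energyForm D T β f f - m * inner ℂ (f : H) (f : H) = _
    rw [energyForm_self, inner_self_eq_norm_sq_to_K]
    push_cast
    rfl
  have h := @InnerProductSpace.Core.inner_mul_inner_self_le ℂ V _ _ _ core g f
  have e1 : (@inner ℂ V core.toInner g f : ℂ) =
      energyForm D T β f g - m * inner ℂ (g : H) (f : H) := rfl
  have e2 : ‖(@inner ℂ V core.toInner f g : ℂ)‖ = ‖(@inner ℂ V core.toInner g f : ℂ)‖ := by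
    rw [← core.conj_inner_symm, RCLike.norm_conj]
  rw [e2, e1, hself, hself, RCLike.re_to_complex, RCLike.re_to_complex, Complex.ofReal_re,
    Complex.ofReal_re] at h
  rw [mul_comm (‖D f‖ ^ 2 - β * ‖T f‖ ^ 2 - m * ‖f‖ ^ 2), sq]
  exact h

omit [CompleteSpace H] [CompleteSpace K] [CompleteSpace B] in
-- Let R be a bounded right inverse of A − m, v a unit near-minimiser and f = Rv. The shifted form
-- pairs f with v to ‖v‖² = 1, so by Cauchy–Schwarz 1 is at most the product of its values at f and
-- at v. The first is ⟨f, v⟩ ≤ ‖R‖ and the second is below 1/(‖R‖ + 1), a contradiction.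
theorem ofReal_mem_spectrumPMap
    (hA : ∀ p : H × H, p ∈ A.graph ↔
      ∃ f : V, (f : H) = p.1 ∧ ∀ v : V, energyForm D T β f v = inner ℂ (v : H) p.2)
    {m : ℝ} (hm : ∀ f : V, m * ‖f‖ ^ 2 ≤ ‖D f‖ ^ 2 - β * ‖T f‖ ^ 2)
    (hm' : ∀ ε > 0, ∃ f : V, ‖f‖ = 1 ∧ ‖D f‖ ^ 2 - β * ‖T f‖ ^ 2 < m + ε) :
    (m : ℂ) ∈ spectrumPMap A := by
  rintro ⟨R, hR, -⟩
  obtain ⟨v, hv1, hv⟩ := hm' (1 / (‖R‖ + 1)) (by positivity)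
  obtain ⟨hd, hAR⟩ := hR v
  obtain ⟨f, hf1, hf⟩ := (hA (R v, A ⟨R v, hd⟩)).1 (A.mem_graph ⟨R v, hd⟩)
  simp only at hf1 hf
  have key : ∀ w : V, energyForm D T β f w - m * inner ℂ (w : H) (f : H) =
      inner ℂ (w : H) (v : H) := by
    intro w
    rw [hf, hf1, ← inner_smul_right, ← inner_sub_right]
    congr 1
  have h1 := norm_energyForm_sub_sq_le hm f v
  rw [key v, inner_self_eq_norm_sq_to_K] at h1
  have hv1' : ‖(v : H)‖ = 1 := hv1
  rw [hv1'] at h1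
  have h2 : ‖D f‖ ^ 2 - β * ‖T f‖ ^ 2 - m * ‖f‖ ^ 2 ≤ ‖R‖ := by
    have h3 := key f
    rw [energyForm_self, inner_self_eq_norm_sq_to_K] at h3
    have h4 : ‖(inner ℂ (f : H) (v : H) : ℂ)‖ ≤ ‖R‖ := by
      refine (norm_inner_le_norm _ _).trans ?_
      rw [hv1', mul_one, hf1]
      simpa [hv1'] using R.le_opNorm (v : H)
    rw [← h3] at h4
    refine le_trans ?_ ((Complex.re_le_norm _).trans h4)
    refine le_of_eq ?_
    rw [Complex.sub_re, Complex.ofReal_re, RCLike.ofReal_eq_complex_ofReal, ← Complex.ofReal_pow, 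
      ← Complex.ofReal_mul, Complex.ofReal_re]
    rfl
  have h5 : ‖D v‖ ^ 2 - β * ‖T v‖ ^ 2 - m * ‖v‖ ^ 2 < 1 / (‖R‖ + 1) := by
    rw [hv1]
    linarith
  have h6 := hm f
  have h7 := hm v
  have h8 : ‖R‖ * (1 / (‖R‖ + 1)) < 1 := by
    rw [mul_one_div, div_lt_one (by positivity)]
    linarith
  have h9 : (‖D f‖ ^ 2 - β * ‖T f‖ ^ 2 - m * ‖f‖ ^ 2) *
      (‖D v‖ ^ 2 - β * ‖T v‖ ^ 2 - m * ‖v‖ ^ 2) ≤ ‖R‖ * (1 / (‖R‖ + 1)) :=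
    mul_le_mul h2 h5.le (by linarith) (norm_nonneg R)
  have h10 := le_trans (by simp : (1 : ℝ) ≤ _) h1
  linarith

end Form

/-! ### The weak gradient is a closed operator -/

section WeakGradient

variable {d : ℕ} {Ω : Set (Eucl d)}

theorem eq_zero_of_forall_integral_smul_eq_zero {F : Type*} [NormedAddCommGroup F]
    [NormedSpace ℝ F] [CompleteSpace F] (hΩ : IsOpen Ω) {f : Eucl d → F}
    (hf : MemLp f 2 (volume.restrict Ω))
    (h : ∀ φ : Eucl d → ℝ, ContDiff ℝ ∞ φ → HasCompactSupport φ → tsupport φ ⊆ Ω →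
      ∫ x in Ω, φ x • f x = 0) : f =ᵐ[volume.restrict Ω] 0 := by
  have := hΩ.ae_eq_zero_of_integral_contDiff_smul_eq_zero
    ((hf.locallyIntegrable one_le_two).locallyIntegrableOn Ω) h
  filter_upwards [this, ae_restrict_mem hΩ.measurableSet] with x hx hxΩ using hx hxΩ

/-- Weak gradients are unique. `Submodule.toLinearPMap` has the given relation as its graph only
when that relation is single-valued, which is what this supplies. -/
theorem IsWeakGradient.eq_zero (hΩ : IsOpen Ω) {G : L2Vec Ω} (h : IsWeakGradient Ω 0 G) :
    G = 0 := by
  have key : ∀ i, (fun x => G x i) =ᵐ[volume.restrict Ω] 0 := by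
    intro i
    refine eq_zero_of_forall_integral_smul_eq_zero hΩ (memLp_coord G i) fun φ h1 h2 h3 => ?_
    rw [← neg_eq_zero, ← h φ h1 h2 h3 i]
    refine integral_eq_zero_of_ae ?_
    filter_upwards [Lp.coeFn_zero ℂ 2 (volume.restrict Ω)] with x hx
    rw [hx]
    exact smul_zero _
  rw [Lp.eq_zero_iff_ae_eq_zero]
  filter_upwards [ae_all_iff.2 key] with x hx
  ext i
  exact hx i

theorem weakGradient_graph (hΩ : IsOpen Ω) (p : L2 Ω × L2Vec Ω) :
    p ∈ (weakGradient Ω).graph ↔ IsWeakGradient Ω p.1 p.2 := by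
  rw [weakGradient, Submodule.toLinearPMap_graph_eq]
  · rfl
  · rintro ⟨f, G⟩ hx (rfl : f = 0)
    exact IsWeakGradient.eq_zero hΩ hx

theorem isWeakGradient_grad (hΩ : IsOpen Ω) (f : H1 Ω) : IsWeakGradient Ω f (grad Ω f) :=
  (weakGradient_graph hΩ _).1 ((weakGradient Ω).mem_graph f)

theorem IsWeakGradient.exists_grad_eq (hΩ : IsOpen Ω) {f : L2 Ω} {G : L2Vec Ω}
    (h : IsWeakGradient Ω f G) : ∃ f' : H1 Ω, (f' : L2 Ω) = f ∧ grad Ω f' = G :=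
  (LinearPMap.mem_graph_iff _).1 ((weakGradient_graph hΩ (f, G)).2 h)

theorem continuous_integral_smul {ψ : Eucl d → ℝ} (hψ : Continuous ψ)
    (hc : HasCompactSupport ψ) : Continuous fun f : L2 Ω => ∫ x in Ω, ψ x • f x := by
  have hm : MemLp (fun x => (ψ x : ℂ)) 2 (volume.restrict Ω) :=
    (Complex.continuous_ofReal.comp hψ).memLp_of_hasCompactSupport
      (hc.comp_left (g := Complex.ofReal) Complex.ofReal_zero)
  have : (fun f : L2 Ω => ∫ x in Ω, ψ x • f x) = fun f : L2 Ω => inner ℂ hm.toLp f := by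
    ext f
    rw [L2.inner_def]
    refine integral_congr_ae ?_
    filter_upwards [hm.coeFn_toLp] with x hx
    rw [hx, RCLike.inner_apply, Complex.conj_ofReal, Complex.real_smul, mul_comm]
  rw [this]
  exact continuous_const.inner continuous_id

/-- Each defining identity compares two continuous functionals of the pair, since testing against a
fixed function is an L² inner product. -/
theorem isClosed_isWeakGradient (Ω : Set (Eucl d)) :
    IsClosed {p : L2 Ω × L2Vec Ω | IsWeakGradient Ω p.1 p.2} := by
  simp only [IsWeakGradient, Set.ofPred_forall]
  refine isClosed_iInter fun φ => isClosed_iInter fun h1 => isClosed_iInter fun h2 =>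
    isClosed_iInter fun _ => isClosed_iInter fun i => ?_
  refine isClosed_eq ((continuous_integral_smul (continuous_partialDeriv h1 i)
    (hasCompactSupport_partialDeriv h2 i)).comp continuous_fst) (Continuous.neg ?_)
  have h := ((continuous_integral_smul (Ω := Ω) h1.continuous h2).comp
    ((EuclideanSpace.proj i : EuclideanSpace ℂ (Fin d) →L[ℂ] ℂ).compLpL 2
      (volume.restrict Ω)).continuous).comp (continuous_snd (X := L2 Ω))
  convert h using 2 with p
  refine integral_congr_ae ?_
  filter_upwards [(EuclideanSpace.proj i : EuclideanSpace ℂ (Fin d) →L[ℂ] ℂ).coeFn_compLpL p.2]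
    with x hx
  rw [hx]
  rfl

theorem isClosed_graph_grad (hΩ : IsOpen Ω) :
    IsClosed {p : L2 Ω × L2Vec Ω | ∃ f : H1 Ω, (f : L2 Ω) = p.1 ∧ grad Ω f = p.2} := by
  convert isClosed_isWeakGradient Ω using 1
  ext p
  refine ⟨?_, fun h => IsWeakGradient.exists_grad_eq hΩ h⟩
  rintro ⟨f, h1, h2⟩
  rw [Set.mem_ofPred_eq, ← h1, ← h2]
  exact isWeakGradient_grad hΩ f

/-! ### Test functions -/

/-- Smooth compactly supported complex-valued functions on the whole space. -/
def IsTest (u : Eucl d → ℂ) : Prop := ContDiff ℝ ∞ u ∧ HasCompactSupport u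

theorem continuous_classicalGradient {u : Eucl d → ℂ} (h : ContDiff ℝ ∞ u) :
    Continuous (classicalGradient u) :=
  (PiLp.continuous_toLp 2 _).comp (continuous_pi fun _ =>
    (h.continuous_fderiv (by simp)).clm_apply continuous_const)

theorem hasCompactSupport_classicalGradient {u : Eucl d → ℂ} (h : HasCompactSupport u) :
    HasCompactSupport (classicalGradient u) := by
  refine h.fderiv (𝕜 := ℝ) |>.mono fun x hx hx' => hx ?_
  ext i
  simp [classicalGradient, partialDeriv, hx']

theorem IsTest.add {u v : Eucl d → ℂ} (hu : IsTest u) (hv : IsTest v) : IsTest (u + v) :=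
  ⟨hu.1.add hv.1, hu.2.add hv.2⟩

theorem IsTest.const_smul {u : Eucl d → ℂ} (c : ℂ) (hu : IsTest u) : IsTest (c • u) :=
  ⟨hu.1.const_smul c, hu.2.smul_left (f := fun _ => c)⟩

theorem classicalGradient_add {u v : Eucl d → ℂ} (hu : IsTest u) (hv : IsTest v) :
    classicalGradient (u + v) = classicalGradient u + classicalGradient v := by
  ext x i
  simp [classicalGradient, partialDeriv,
    fderiv_add (hu.1.differentiable (by simp) x) (hv.1.differentiable (by simp) x)]

theorem classicalGradient_const_smul {u : Eucl d → ℂ} (c : ℂ) (hu : IsTest u) :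
    classicalGradient (c • u) = c • classicalGradient u := by
  ext x i
  simp [classicalGradient, partialDeriv,
    fderiv_const_smul (hu.1.differentiable (by simp) x) c]

theorem IsTest.memLp {u : Eucl d → ℂ} (hu : IsTest u) : MemLp u 2 (volume.restrict Ω) :=
  hu.1.continuous.memLp_of_hasCompactSupport hu.2

theorem IsTest.memLp_gradient {u : Eucl d → ℂ} (hu : IsTest u) :
    MemLp (classicalGradient u) 2 (volume.restrict Ω) :=
  (continuous_classicalGradient hu.1).memLp_of_hasCompactSupport
    (hasCompactSupport_classicalGradient hu.2)

theorem integral_partialDeriv_smul {F : Type*} [NormedAddCommGroup F] [NormedSpace ℝ F]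
    {φ : Eucl d → ℝ} {u : Eucl d → F} (h1 : ContDiff ℝ ∞ φ)
    (h2 : HasCompactSupport φ) (hu : ContDiff ℝ ∞ u) (i : Fin d) :
    ∫ x, partialDeriv i φ x • u x = -∫ x, φ x • partialDeriv i u x := by
  have c1 := continuous_partialDeriv h1 i
  have c2 : Continuous (partialDeriv i u) :=
    (hu.continuous_fderiv (by simp)).clm_apply continuous_const
  rw [eq_neg_iff_add_eq_zero, add_comm, ← eq_neg_iff_add_eq_zero]
  refine integral_smul_fderiv_eq_neg_fderiv_smul_of_integrable ?_ ?_ ?_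
    (fun x _ => h1.differentiable (by simp) x) (fun x _ => hu.differentiable (by simp) x)
  · exact (c1.smul hu.continuous).integrable_of_hasCompactSupport
      (hasCompactSupport_partialDeriv h2 i).smul_right
  · exact (h1.continuous.smul c2).integrable_of_hasCompactSupport h2.smul_right
  · exact (h1.continuous.smul hu.continuous).integrable_of_hasCompactSupport h2.smul_right

theorem partialDeriv_eq_zero_of_notMem {F : Type*} [NormedAddCommGroup F] [NormedSpace ℝ F]
    {φ : Eucl d → F} {x : Eucl d} (hx : x ∉ tsupport φ) (i : Fin d) : partialDeriv i φ x = 0 := by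
  have : fderiv ℝ φ x = 0 := by
    by_contra h
    exact hx (support_fderiv_subset ℝ h)
  rw [partialDeriv, this, _root_.zero_apply]

/-- The function tested against is supported inside Ω, so both integrals extend to the whole space,
where integration by parts has no boundary term. -/
theorem IsTest.isWeakGradient {u : Eucl d → ℂ} (hu : IsTest u) :
    IsWeakGradient Ω hu.memLp.toLp hu.memLp_gradient.toLp := by
  intro φ h1 h2 h3 i
  have e1 : ∫ x in Ω, partialDeriv i φ x • ((hu.memLp (Ω := Ω)).toLp u : L2 Ω) x =
      ∫ x, partialDeriv i φ x • u x := by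
    refine Eq.trans ?_ (setIntegral_eq_integral_of_forall_compl_eq_zero (s := Ω) (μ := volume) ?_)
    · refine integral_congr_ae ?_
      filter_upwards [(hu.memLp (Ω := Ω)).coeFn_toLp] with x hx
      rw [hx]
    · intro x hx
      rw [partialDeriv_eq_zero_of_notMem (fun h => hx (h3 h)), zero_smul]
  have e2 : ∫ x in Ω, φ x • ((hu.memLp_gradient (Ω := Ω)).toLp _ : L2Vec Ω) x i =
      ∫ x, φ x • partialDeriv i u x := by
    refine Eq.trans ?_ (setIntegral_eq_integral_of_forall_compl_eq_zero (s := Ω) (μ := volume) ?_)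
    · refine integral_congr_ae ?_
      filter_upwards [(hu.memLp_gradient (Ω := Ω)).coeFn_toLp] with x hx
      rw [hx]
      rfl
    · intro x hx
      rw [image_eq_zero_of_notMem_tsupport (fun h => hx (h3 h)), zero_smul]
  rw [e1, e2, integral_partialDeriv_smul h1 h2 hu.1]

/-- Density of H¹(Ω) in L²(Ω), in the form that makes the Robin Laplacian single-valued. -/
theorem eq_zero_of_forall_inner_eq_zero (hΩ : IsOpen Ω) {h : L2 Ω}
    (hh : ∀ v : H1 Ω, inner ℂ (v : L2 Ω) h = 0) : h = 0 := by
  rw [Lp.eq_zero_iff_ae_eq_zero]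
  refine eq_zero_of_forall_integral_smul_eq_zero hΩ (Lp.memLp h) fun φ h1 h2 _ => ?_
  have hu : IsTest fun x => (φ x : ℂ) :=
    ⟨Complex.ofRealCLM.contDiff.comp h1, h2.comp_left (g := Complex.ofReal) Complex.ofReal_zero⟩
  obtain ⟨v, hv, -⟩ := IsWeakGradient.exists_grad_eq hΩ (hu.isWeakGradient (Ω := Ω))
  rw [← hh v, hv, L2.inner_def]
  refine integral_congr_ae ?_
  filter_upwards [(hu.memLp (Ω := Ω)).coeFn_toLp] with x hx
  rw [hx, RCLike.inner_apply, Complex.conj_ofReal, Complex.real_smul, mul_comm]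

theorem partialDeriv_mul {φ χ : Eucl d → ℝ} (h1 : ContDiff ℝ ∞ φ) (h2 : ContDiff ℝ ∞ χ)
    (i : Fin d) (x : Eucl d) :
    partialDeriv i (fun y => φ y * χ y) x =
      partialDeriv i φ x * χ x + φ x * partialDeriv i χ x := by
  simp only [partialDeriv]
  rw [fderiv_fun_mul (h1.differentiable (by simp) x) (h2.differentiable (by simp) x)]
  simp only [_root_.add_apply, _root_.smul_apply, smul_eq_mul]
  ring

/-- The product rule for weak gradients, tested against functions whose support meets that of the
cutoff function inside `Ω`. -/
theorem IsWeakGradient.integral_cutoff {f : L2 Ω} {G : L2Vec Ω} (h : IsWeakGradient Ω f G)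
    {χ φ : Eucl d → ℝ} (hχ : ContDiff ℝ ∞ χ) (h1 : ContDiff ℝ ∞ φ)
    (h2 : HasCompactSupport φ) (h3 : tsupport φ ∩ tsupport χ ⊆ Ω) (i : Fin d) :
    ∫ x in Ω, partialDeriv i φ x • (χ x • f x) =
      -∫ x in Ω, φ x • (χ x • G x i + partialDeriv i χ x • f x) := by
  have hs : tsupport (fun x => φ x * χ x) ⊆ tsupport φ ∩ tsupport χ :=
    Set.subset_inter (tsupport_mul_subset_left (f := φ) (g := χ))
      (tsupport_mul_subset_right (f := φ) (g := χ))
  have key := h (fun x => φ x * χ x) (h1.mul hχ) h2.mul_right (hs.trans h3) i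
  have c1 := continuous_partialDeriv h1 i
  have c2 := continuous_partialDeriv hχ i
  have i1 : Integrable (fun x => (partialDeriv i φ x * χ x) • f x) (volume.restrict Ω) :=
    integrable_smul_of_test (Lp.memLp f) (c1.mul hχ.continuous)
      (hasCompactSupport_partialDeriv h2 i).mul_right
  have i2 : Integrable (fun x => (φ x * partialDeriv i χ x) • f x) (volume.restrict Ω) :=
    integrable_smul_of_test (Lp.memLp f) (h1.continuous.mul c2) h2.mul_right
  have i3 : Integrable (fun x => (φ x * χ x) • G x i) (volume.restrict Ω) :=
    integrable_smul_of_test (memLp_coord G i) (h1.continuous.mul hχ.continuous) h2.mul_right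
  simp only [partialDeriv_mul h1 hχ, add_smul] at key
  rw [integral_add i1 i2] at key
  simp only [smul_add, smul_smul]
  rw [integral_add i3 i2, neg_add, ← key]
  ring

end WeakGradient

/-! ### The trace inequality for test functions -/

section TraceInequality

theorem sq_integral_le_mul_integral_sq {k : ℝ → ℝ} (hk : Continuous k) {δ : ℝ} (hδ : 0 < δ) :
    (∫ s in 0..δ, k s) ^ 2 ≤ δ * ∫ s in 0..δ, k s ^ 2 := by
  set c := (∫ s in 0..δ, k s) / δ with hc
  -- Cauchy–Schwarz through the variance: `c` is the mean of `k` on [0, δ].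
  have h0 : 0 ≤ ∫ s in 0..δ, (k s - c) ^ 2 :=
    intervalIntegral.integral_nonneg hδ.le fun s _ => sq_nonneg _
  have h1 : ∫ s in 0..δ, (k s - c) ^ 2 =
      (∫ s in 0..δ, k s ^ 2) - 2 * c * (∫ s in 0..δ, k s) + c ^ 2 * δ := by
    have : (fun s => (k s - c) ^ 2) = fun s => k s ^ 2 - 2 * c * k s + c ^ 2 := by
      ext s
      ring
    rw [this, intervalIntegral.integral_add, intervalIntegral.integral_sub,
      intervalIntegral.integral_const_mul, intervalIntegral.integral_const]
    · simp [mul_comm]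
    all_goals exact Continuous.intervalIntegrable (by fun_prop) _ _
  have h2 : (∫ s in 0..δ, k s) = c * δ := by
    rw [hc]
    field_simp
  rw [h1, h2] at h0
  rw [h2]
  nlinarith

/-- The one-dimensional trace inequality: bound ‖h 0‖ by ‖h s‖ plus the integral of `k`, square, and
average over s in [0, δ]. Small δ makes the derivative term cheap at the price of 2/δ in front of
the other one. -/
theorem norm_sq_le_integral {h h' : ℝ → ℂ} {k : ℝ → ℝ} (hd : ∀ s, HasDerivAt h (h' s) s)
    (hc : Continuous h') (hk : Continuous k) (hb : ∀ s, ‖h' s‖ ≤ k s) {δ : ℝ} (hδ : 0 < δ) :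
    ‖h 0‖ ^ 2 ≤ 2 / δ * (∫ s in 0..δ, ‖h s‖ ^ 2) + 2 * δ * ∫ s in 0..δ, k s ^ 2 := by
  have hcont : Continuous h := continuous_iff_continuousAt.2 fun s => (hd s).continuousAt
  have h1 : ∀ s ∈ Set.Icc 0 δ, ‖h 0‖ ≤ ‖h s‖ + ∫ r in 0..δ, k r := by
    intro s hs
    have e1 : ∫ r in 0..s, h' r = h s - h 0 :=
      intervalIntegral.integral_eq_sub_of_hasDerivAt (fun r _ => hd r) (hc.intervalIntegrable _ _)
    have e2 : ‖∫ r in 0..s, h' r‖ ≤ ∫ r in 0..s, k r :=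
      intervalIntegral.norm_integral_le_of_norm_le hs.1 (ae_of_all _ fun r _ => hb r)
        (hk.intervalIntegrable _ _)
    have e3 : ∫ r in 0..s, k r ≤ ∫ r in 0..δ, k r :=
      intervalIntegral.integral_mono_interval le_rfl hs.1 hs.2
        (ae_of_all _ fun r => (norm_nonneg _).trans (hb r)) (hk.intervalIntegrable _ _)
    rw [e1] at e2
    have e4 := norm_sub_norm_le (h 0) (h s)
    rw [norm_sub_rev] at e4
    linarith
  have h2 := sq_integral_le_mul_integral_sq hk hδ
  have h3 : ∀ s ∈ Set.Icc 0 δ, ‖h 0‖ ^ 2 ≤ 2 * ‖h s‖ ^ 2 + 2 * (δ * ∫ s in 0..δ, k s ^ 2) := by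
    intro s hs
    have e1 := h1 s hs
    have e2 := pow_le_pow_left₀ (norm_nonneg (h 0)) e1 2
    nlinarith [sq_nonneg (‖h s‖ - ∫ r in 0..δ, k r)]
  have h4 := intervalIntegral.integral_mono_on hδ.le
    (continuous_const.intervalIntegrable (μ := volume) 0 δ)
    (Continuous.intervalIntegrable (by fun_prop) 0 δ) h3
  rw [intervalIntegral.integral_add (Continuous.intervalIntegrable (by fun_prop) 0 δ)
    (continuous_const.intervalIntegrable 0 δ), intervalIntegral.integral_const_mul,
    intervalIntegral.integral_const, intervalIntegral.integral_const, sub_zero, smul_eq_mul,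
    smul_eq_mul] at h4
  have h5 : ‖h 0‖ ^ 2 = 1 / δ * (δ * ‖h 0‖ ^ 2) := by field_simp
  have h6 := mul_le_mul_of_nonneg_left h4 (by positivity : 0 ≤ 1 / δ)
  rw [h5]
  refine h6.trans (le_of_eq ?_)
  field_simp

variable {d : ℕ}

theorem fderiv_eq_sum (u : Eucl d → ℂ) (p n : Eucl d) :
    fderiv ℝ u p n = ∑ i, (n i : ℂ) * classicalGradient u p i := by
  conv_lhs => rw [← (EuclideanSpace.basisFun (Fin d) ℝ).sum_repr n]
  simp [classicalGradient, partialDeriv]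

theorem norm_fderiv_apply_le (u : Eucl d → ℂ) (p : Eucl d) {n : Eucl d} (hn : ‖n‖ = 1) :
    ‖fderiv ℝ u p n‖ ≤ ‖classicalGradient u p‖ := by
  have h : fderiv ℝ u p n =
      inner ℂ (WithLp.toLp 2 fun i => (n i : ℂ)) (classicalGradient u p) := by
    rw [fderiv_eq_sum, PiLp.inner_apply]
    refine Finset.sum_congr rfl fun i _ => ?_
    rw [RCLike.inner_apply, Complex.conj_ofReal, mul_comm]
  rw [h]
  refine (norm_inner_le_norm _ _).trans (le_of_eq ?_)
  have : ‖(WithLp.toLp 2 fun i => (n i : ℂ) : EuclideanSpace ℂ (Fin d))‖ = ‖n‖ := by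
    simp [EuclideanSpace.norm_eq]
  rw [this, hn, one_mul]

theorem ofReal_intervalIntegral {f : ℝ → ℝ} (hf : Continuous f) (h0 : ∀ s, 0 ≤ f s) {δ : ℝ}
    (hδ : 0 ≤ δ) :
    ENNReal.ofReal (∫ s in 0..δ, f s) = ∫⁻ s in Set.Ioc 0 δ, ENNReal.ofReal (f s) := by
  rw [intervalIntegral.integral_of_le hδ]
  exact ofReal_integral_eq_lintegral_ofReal
    ((intervalIntegrable_iff_integrableOn_Ioc_of_le hδ).1 (hf.intervalIntegrable _ _))
    (ae_of_all _ h0)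

theorem ofReal_norm_sq {E : Type*} [SeminormedAddGroup E] (x : E) :
    ENNReal.ofReal (‖x‖ ^ 2) = ‖x‖ₑ ^ 2 := by
  rw [ENNReal.ofReal_pow (norm_nonneg x), ofReal_norm]

theorem enorm_sq_le_lintegral_segment {u : Eucl d → ℂ} (hu : ContDiff ℝ ∞ u) (p : Eucl d)
    {n : Eucl d} (hn : ‖n‖ = 1) {δ : ℝ} (hδ : 0 < δ) :
    ‖u p‖ₑ ^ 2 ≤ ENNReal.ofReal (2 / δ) * (∫⁻ s in Set.Ioc 0 δ, ‖u (p + s • n)‖ₑ ^ 2) +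
      ENNReal.ofReal (2 * δ) * ∫⁻ s in Set.Ioc 0 δ, ‖classicalGradient u (p + s • n)‖ₑ ^ 2 := by
  have cg := continuous_classicalGradient hu
  have cu := hu.continuous
  have hline : Continuous fun s : ℝ => p + s • n := by fun_prop
  have h := norm_sq_le_integral (h := fun s => u (p + s • n))
    (h' := fun s => fderiv ℝ u (p + s • n) n) (k := fun s => ‖classicalGradient u (p + s • n)‖)
    (fun s => by
      have h1 : HasDerivAt (fun s : ℝ => p + s • n) n s := by
        simpa using ((hasDerivAt_id s).smul_const n).const_add p
      exact ((hu.differentiable (by simp) _).hasFDerivAt).comp_hasDerivAt s h1)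
    (((hu.continuous_fderiv (by simp)).comp hline).clm_apply continuous_const)
    (by fun_prop) (fun s => norm_fderiv_apply_le u _ hn) hδ
  have h' := ENNReal.ofReal_le_ofReal h
  simp only [zero_smul, add_zero] at h'
  have nn1 : 0 ≤ ∫ s in 0..δ, ‖u (p + s • n)‖ ^ 2 :=
    intervalIntegral.integral_nonneg hδ.le fun s _ => sq_nonneg _
  have nn2 : 0 ≤ ∫ s in 0..δ, ‖classicalGradient u (p + s • n)‖ ^ 2 :=
    intervalIntegral.integral_nonneg hδ.le fun s _ => sq_nonneg _
  rw [ENNReal.ofReal_add (by positivity) (by positivity), ENNReal.ofReal_mul (by positivity),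
    ENNReal.ofReal_mul (by positivity),
    ofReal_intervalIntegral (by fun_prop) (fun s => sq_nonneg _) hδ.le,
    ofReal_intervalIntegral (by fun_prop) (fun s => sq_nonneg _) hδ.le] at h'
  simpa only [ofReal_norm_sq] using h'

/-! #### Cartesian coordinates and Lipschitz graphs -/

variable {e : Eucl d ≃ᵢ WithLp 2 (Eucl (d - 1) × ℝ)}

/-- The point with coordinates `(x, t)`. -/
noncomputable def coordPoint (e : Eucl d ≃ᵢ WithLp 2 (Eucl (d - 1) × ℝ))
    (p : Eucl (d - 1) × ℝ) : Eucl d :=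
  e.symm (WithLp.toLp 2 p)

theorem apply_coordPoint (p : Eucl (d - 1) × ℝ) : e (coordPoint e p) = WithLp.toLp 2 p :=
  e.apply_symm_apply _

theorem coordPoint_apply (p : Eucl d) : coordPoint e ((e p).fst, (e p).snd) = p :=
  e.symm_apply_apply p

theorem continuous_coordPoint : Continuous (coordPoint e) :=
  e.symm.continuous.comp (WithLp.prod_continuous_toLp 2 _ _)

theorem coordPoint_mem_specialDomain {ψ : Eucl (d - 1) → ℝ} (p : Eucl (d - 1) × ℝ) :
    coordPoint e p ∈ specialDomain e ψ ↔ ψ p.1 < p.2 := by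
  simp [specialDomain, apply_coordPoint]

/-- The unit vector in the direction of the last coordinate. -/
noncomputable def vertical (e : Eucl d ≃ᵢ WithLp 2 (Eucl (d - 1) × ℝ)) : Eucl d :=
  e.symm.toRealAffineIsometryEquiv.linearIsometryEquiv (WithLp.toLp 2 (0, 1))

theorem norm_vertical : ‖vertical e‖ = 1 := by
  rw [vertical, LinearIsometryEquiv.norm_map]
  simp

theorem coordPoint_add (x : Eucl (d - 1)) (t s : ℝ) :
    coordPoint e (x, t + s) = coordPoint e (x, t) + s • vertical e := by
  have h := e.symm.toRealAffineIsometryEquiv.map_vadd (WithLp.toLp 2 (x, t))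
    (s • WithLp.toLp 2 (0, 1))
  rw [map_smul, vadd_eq_add, vadd_eq_add, add_comm _ (e.symm.toRealAffineIsometryEquiv _)] at h
  rw [coordPoint, coordPoint, vertical]
  rw [IsometryEquiv.coeFn_toRealAffineIsometryEquiv] at h
  rw [← h]
  congr 1
  refine (WithLp.ofLp_injective 2) (Prod.ext ?_ ?_)
  · simp
  · simp [add_comm]

/-- An isometry preserves d-dimensional Hausdorff measure, which is Lebesgue measure on both sides.
With truncated subtraction, the coordinate space has dimension (d − 1) + 1 = d only for d ≥ 1. -/
theorem measurePreserving_coordPoint (hd : 1 ≤ d) :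
    MeasurePreserving (coordPoint e) volume volume := by
  have h1 := e.symm.measurePreserving_euclideanHausdorffMeasure d
  rw [EuclideanSpace.euclideanHausdorffMeasure_eq_volume] at h1
  have hf : Module.finrank ℝ (WithLp 2 (Eucl (d - 1) × ℝ)) = d := by
    rw [(WithLp.linearEquiv 2 ℝ (Eucl (d - 1) × ℝ)).finrank_eq, Module.finrank_prod]
    simp
    omega
  have h2 := InnerProductSpace.euclideanHausdorffMeasure_eq_volume
    (V := WithLp 2 (Eucl (d - 1) × ℝ))
  rw [hf] at h2
  rw [h2] at h1
  exact h1.comp (WithLp.volume_preserving_toLp _ _)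

/-- The parametrisation of the graph of `ψ`. -/
noncomputable def graphPoint (e : Eucl d ≃ᵢ WithLp 2 (Eucl (d - 1) × ℝ)) (ψ : Eucl (d - 1) → ℝ)
    (x : Eucl (d - 1)) : Eucl d :=
  coordPoint e (x, ψ x)

theorem lipschitzWith_graphPoint {ψ : Eucl (d - 1) → ℝ} {M : ℝ≥0} (hψ : LipschitzWith M ψ) :
    LipschitzWith (1 + M) (graphPoint e ψ) := by
  refine LipschitzWith.of_dist_le_mul fun x y => ?_
  rw [graphPoint, graphPoint, coordPoint, coordPoint, e.symm.dist_eq,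
    WithLp.prod_dist_eq_of_L2]
  have h1 := hψ.dist_le_mul x y
  refine (Real.sqrt_le_sqrt (y := ((1 + M : ℝ≥0) * dist x y) ^ 2) ?_).trans
    (le_of_eq (Real.sqrt_sq (by positivity)))
  push_cast
  have h2 := dist_nonneg (x := x) (y := y)
  have h3 := dist_nonneg (x := ψ x) (y := ψ y)
  have h4 : 0 ≤ (M : ℝ) := M.2
  have h5 := mul_nonneg h4 h2
  change dist x y ^ 2 + dist (ψ x) (ψ y) ^ 2 ≤ _
  nlinarith

theorem euclideanHausdorffMeasure_image_le_of_lipschitzWith {X Y : Type*} [EMetricSpace X]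
    [MeasurableSpace X] [BorelSpace X] [EMetricSpace Y] [MeasurableSpace Y] [BorelSpace Y]
    {f : X → Y} {C : ℝ≥0} (h : LipschitzWith C f) (k : ℕ) (s : Set X) :
    Measure.euclideanHausdorffMeasure k (f '' s) ≤
      (C : ℝ≥0∞) ^ k * Measure.euclideanHausdorffMeasure k s := by
  simp only [Measure.euclideanHausdorffMeasure_def, Measure.smul_apply, ENNReal.smul_def,
    smul_eq_mul]
  rw [mul_left_comm]
  gcongr
  have := h.hausdorffMeasure_image_le (d := k) k.cast_nonneg s
  rwa [ENNReal.rpow_natCast] at this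

/-- Only an upper bound for surface measure is needed, so the Lipschitz constant of the
parametrisation replaces the area formula. -/
theorem restrict_range_graphPoint_le {ψ : Eucl (d - 1) → ℝ} {M : ℝ≥0} (hψ : LipschitzWith M ψ) :
    (Measure.euclideanHausdorffMeasure (d - 1)).restrict (Set.range (graphPoint e ψ)) ≤
      ((1 + M : ℝ≥0) : ℝ≥0∞) ^ (d - 1) • volume.map (graphPoint e ψ) := by
  have hγ := lipschitzWith_graphPoint (e := e) hψ
  refine Measure.le_iff.2 fun s hs => ?_
  rw [Measure.restrict_apply hs, Measure.smul_apply, Measure.map_apply hγ.continuous.measurable hs,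
    ← Set.image_preimage_eq_inter_range, smul_eq_mul,
    ← EuclideanSpace.euclideanHausdorffMeasure_eq_volume]
  exact euclideanHausdorffMeasure_image_le_of_lipschitzWith hγ _ _

/-- Vertical segments over distinct base points are disjoint and sweep out a part of `O`. In
coordinates (x, t) this is Tonelli together with the translation t = ψ x + s on each vertical line.
-/
theorem lintegral_segment_le (hd : 1 ≤ d) {ψ : Eucl (d - 1) → ℝ} {M : ℝ≥0}
    (hψ : LipschitzWith M ψ) {S O : Set (Eucl d)} (hS : MeasurableSet S) (hO : MeasurableSet O)
    (hSγ : S ⊆ Set.range (graphPoint e ψ)) {δ : ℝ}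
    (hSO : ∀ p ∈ S, ∀ s ∈ Set.Ioc 0 δ, p + s • vertical e ∈ O) {F : Eucl d → ℝ≥0∞}
    (hF : Measurable F) :
    ∫⁻ p in S, (∫⁻ s in Set.Ioc 0 δ, F (p + s • vertical e))
        ∂Measure.euclideanHausdorffMeasure (d - 1) ≤
      ((1 + M : ℝ≥0) : ℝ≥0∞) ^ (d - 1) * ∫⁻ p in O, F p := by
  have hγ := (lipschitzWith_graphPoint (e := e) hψ).continuous.measurable
  have hm : Measurable fun p => ∫⁻ s in Set.Ioc 0 δ, F (p + s • vertical e) := by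
    refine Measurable.lintegral_prod_right'
      (f := fun q : Eucl d × ℝ => F (q.1 + q.2 • vertical e)) ?_
    exact hF.comp (by fun_prop)
  have h1 : (Measure.euclideanHausdorffMeasure (d - 1)).restrict S ≤
      ((1 + M : ℝ≥0) : ℝ≥0∞) ^ (d - 1) • (volume.map (graphPoint e ψ)).restrict S := by
    have := Measure.restrict_mono le_rfl (restrict_range_graphPoint_le (e := e) hψ) (s := S)
    rwa [Measure.restrict_restrict hS, Set.inter_eq_left.2 hSγ, Measure.restrict_smul] at this
  refine (lintegral_mono' h1 le_rfl).trans ?_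
  rw [lintegral_smul_measure, smul_eq_mul]
  refine mul_le_mul_right ?_ _
  rw [← lintegral_indicator hS, lintegral_map (hm.indicator hS) hγ, ← lintegral_indicator hO,
    ← (measurePreserving_coordPoint (e := e) hd).lintegral_comp (hF.indicator hO),
    Measure.volume_eq_prod, lintegral_prod (fun q => O.indicator F (coordPoint e q))
      ((hF.indicator hO).comp continuous_coordPoint.measurable).aemeasurable]
  refine lintegral_mono fun x => ?_
  by_cases hx : graphPoint e ψ x ∈ S
  · rw [Set.indicator_of_mem hx, ← lintegral_indicator measurableSet_Ioc]
    refine le_trans ?_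
      (lintegral_add_left_eq_self (fun t => O.indicator F (coordPoint e (x, t))) (ψ x)).le
    refine lintegral_mono fun s => ?_
    by_cases hs : s ∈ Set.Ioc 0 δ
    · have := hSO _ hx s hs
      simp only [Set.indicator_of_mem hs, coordPoint_add]
      rw [Set.indicator_of_mem (by exact this)]
      rfl
    · rw [Set.indicator_of_notMem hs]
      exact zero_le
  · rw [Set.indicator_of_notMem hx]
    exact zero_le

/-! #### The boundary in local coordinates -/

theorem snd_eq_of_mem_frontier {Ω U : Set (Eucl d)} (hΩ : IsOpen Ω) (hU : IsOpen U)
    {ψ : Eucl (d - 1) → ℝ} (hψ : Continuous ψ) (h : U ∩ Ω = U ∩ specialDomain e ψ) {p : Eucl d}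
    (hp : p ∈ frontier Ω) (hpU : p ∈ U) : ψ (e p).fst = (e p).snd := by
  have c1 : Continuous fun q => ψ (e q).fst :=
    hψ.comp ((WithLp.prod_continuous_ofLp 2 _ _).fst.comp e.continuous)
  have c2 : Continuous fun q => (e q).snd :=
    (WithLp.prod_continuous_ofLp 2 _ _).snd.comp e.continuous
  rw [hΩ.frontier_eq] at hp
  refine le_antisymm ?_ ?_
  · have : p ∈ closure (U ∩ Ω) := hU.inter_closure ⟨hpU, hp.1⟩
    rw [h] at this
    have hcl : IsClosed {q | ψ (e q).fst ≤ (e q).snd} := isClosed_le c1 c2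
    exact closure_minimal (fun q hq => le_of_lt (a := ψ (e q).fst) hq.2) hcl this
  · by_contra! hlt
    exact hp.2 (h.symm ▸ (⟨hpU, hlt⟩ : p ∈ U ∩ specialDomain e ψ) : p ∈ U ∩ Ω).2

theorem graphPoint_mem_frontier {Ω U : Set (Eucl d)} (hΩ : IsOpen Ω) (hU : IsOpen U)
    {ψ : Eucl (d - 1) → ℝ} (h : U ∩ Ω = U ∩ specialDomain e ψ)
    {x : Eucl (d - 1)} (hx : graphPoint e ψ x ∈ U) : graphPoint e ψ x ∈ frontier Ω := by
  rw [hΩ.frontier_eq]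
  refine ⟨?_, fun hxΩ => ?_⟩
  · have ht : Tendsto (fun s : ℝ => coordPoint e (x, ψ x + s)) (𝓝[>] 0) (𝓝 (graphPoint e ψ x)) := by
      have hc : Continuous fun s : ℝ => coordPoint e (x, ψ x + s) :=
        continuous_coordPoint.comp (by fun_prop)
      have := hc.tendsto 0
      simp only [add_zero] at this
      exact this.mono_left nhdsWithin_le_nhds
    refine mem_closure_of_tendsto ht ?_
    filter_upwards [ht.eventually (hU.mem_nhds hx), self_mem_nhdsWithin] with s hs hs0
    have : coordPoint e (x, ψ x + s) ∈ U ∩ specialDomain e ψ :=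
      ⟨hs, (coordPoint_mem_specialDomain _).2 (by simpa using hs0)⟩
    rw [← h] at this
    exact this.2
  · have : graphPoint e ψ x ∈ U ∩ specialDomain e ψ := h ▸ ⟨hx, hxΩ⟩
    exact lt_irrefl _ ((coordPoint_mem_specialDomain _).1 this.2)

/-- A boundary point lies on the graph, so moving up enters the special domain; the ball of radius ε
keeps the segment in the chart. This uniform length permits one δ for all charts. -/
theorem add_smul_vertical_mem {Ω U : Set (Eucl d)} (hΩ : IsOpen Ω) (hU : IsOpen U)
    {ψ : Eucl (d - 1) → ℝ} (hψ : Continuous ψ) (h : U ∩ Ω = U ∩ specialDomain e ψ) {p : Eucl d}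
    (hp : p ∈ frontier Ω) {ε : ℝ} (hpU : Metric.ball p ε ⊆ U) {s : ℝ} (h0 : 0 < s) (hs : s < ε) :
    p + s • vertical e ∈ U ∩ Ω := by
  have hpp : p ∈ U := hpU (Metric.mem_ball_self (h0.trans hs))
  rw [h]
  refine ⟨hpU ?_, ?_⟩
  · rw [mem_ball_iff_norm, add_sub_cancel_left, norm_smul, norm_vertical, mul_one,
      Real.norm_eq_abs, abs_of_pos h0]
    exact hs
  · have h1 := snd_eq_of_mem_frontier hΩ hU hψ h hp hpp
    rw [← coordPoint_apply (e := e) p, ← coordPoint_add, coordPoint_mem_specialDomain]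
    simp only [h1]
    linarith

theorem measurableSet_ball_subset (ε : ℝ) (U : Set (Eucl d)) :
    MeasurableSet {x | Metric.ball x ε ⊆ U} := by
  have : {x | Metric.ball x ε ⊆ U} = ⋂ y ∈ Uᶜ, {x | ε ≤ dist y x} := by
    ext x
    simp only [Set.mem_ofPred_eq, Set.mem_iInter, Set.subset_def, Metric.mem_ball,
      Set.mem_compl_iff]
    exact forall_congr' fun y => by rw [not_imp_comm, not_le]
  rw [this]
  exact (isClosed_biInter fun y _ => isClosed_le continuous_const (by fun_prop)).measurableSet

/-- At each point the indicators of the `U j` add up to at most N. -/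
theorem tsum_setLIntegral_le {ι : Type*} [Countable ι] {U : ι → Set (Eucl d)} {Ω : Set (Eucl d)}
    (hU : ∀ j, MeasurableSet (U j)) {N : ℕ} (hN : ∀ x, {j | x ∈ U j}.encard ≤ N)
    {F : Eucl d → ℝ≥0∞} (hF : Measurable F) :
    ∑' j, ∫⁻ x in U j ∩ Ω, F x ≤ N * ∫⁻ x in Ω, F x := by
  have h1 : ∀ j, ∫⁻ x in U j ∩ Ω, F x = ∫⁻ x in Ω, (U j).indicator F x := fun j => by
    rw [lintegral_indicator (hU j), Measure.restrict_restrict (hU j)]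
  simp_rw [h1]
  rw [← lintegral_tsum fun j => (hF.indicator (hU j)).aemeasurable,
    ← lintegral_const_mul _ hF]
  refine lintegral_mono fun x => ?_
  have h2 : ∀ j, (U j).indicator F x = {j | x ∈ U j}.indicator (fun _ => 1) j * F x := by
    intro j
    by_cases hj : x ∈ U j
    · rw [Set.indicator_of_mem hj, Set.indicator_of_mem (by exact hj), one_mul]
    · rw [Set.indicator_of_notMem hj, Set.indicator_of_notMem (by exact hj), zero_mul]
  simp only [h2]
  rw [ENNReal.tsum_mul_right, ← tsum_subtype, ENNReal.tsum_set_one]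
  gcongr
  exact_mod_cast (ENat.toENNReal_mono (hN x))

/-- The boundary is covered by the pieces whose points have their ε-ball inside a fixed `U j`. On
each piece the segment estimate is integrated and swept into `U j ∩ Ω`, and bounded overlap sums the
results. `C` depends on neither δ nor `u`, so the gradient coefficient can be made arbitrarily
small. -/
theorem IsLipschitzDomain.exists_trace_bound (hd : 1 ≤ d) {Ω : Set (Eucl d)}
    (hΩ : IsLipschitzDomain Ω) :
    ∃ (ε : ℝ) (C : ℝ≥0), 0 < ε ∧ ∀ δ, 0 < δ → δ < ε → ∀ u : Eucl d → ℂ, ContDiff ℝ ∞ u →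
      ∫⁻ x, ‖u x‖ₑ ^ 2 ∂surfaceMeasure Ω ≤
        C * (ENNReal.ofReal (2 / δ) * (∫⁻ x in Ω, ‖u x‖ₑ ^ 2) +
          ENNReal.ofReal (2 * δ) * ∫⁻ x in Ω, ‖classicalGradient u x‖ₑ ^ 2) := by
  obtain ⟨ε, N, M, ι, _, U, hε, hUo, hcov, hN, hchart⟩ := hΩ.exists_cover
  refine ⟨ε, (1 + M) ^ (d - 1) * N, hε, fun δ h0 hδ u hu => ?_⟩
  choose e ψ hψ hUΩ using hchart
  set S : ι → Set (Eucl d) := fun j => frontier Ω ∩ {x | Metric.ball x ε ⊆ U j} with hS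
  have hSm : ∀ j, MeasurableSet (S j) := fun j =>
    isClosed_frontier.measurableSet.inter (measurableSet_ball_subset ε (U j))
  have hsub : frontier Ω ⊆ ⋃ j, S j := fun x hx => by
    obtain ⟨j, hj⟩ := hcov x hx
    exact Set.mem_iUnion.2 ⟨j, hx, hj⟩
  have m1 : Measurable fun x => ‖u x‖ₑ ^ 2 := (hu.continuous.enorm.measurable).pow_const 2
  have m2 : Measurable fun x => ‖classicalGradient u x‖ₑ ^ 2 :=
    ((continuous_classicalGradient hu).enorm.measurable).pow_const 2
  have hmeas : ∀ (F : Eucl d → ℝ≥0∞), Measurable F → ∀ n : Eucl d,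
      Measurable fun p => ∫⁻ s in Set.Ioc 0 δ, F (p + s • n) := fun F hF n =>
    Measurable.lintegral_prod_right' (f := fun q : Eucl d × ℝ => F (q.1 + q.2 • n))
      (hF.comp (by fun_prop))
  have piece : ∀ j, ∀ F : Eucl d → ℝ≥0∞, Measurable F →
      ∫⁻ p in S j, (∫⁻ s in Set.Ioc 0 δ, F (p + s • vertical (e j)))
        ∂Measure.euclideanHausdorffMeasure (d - 1) ≤
      ((1 + M : ℝ≥0) : ℝ≥0∞) ^ (d - 1) * ∫⁻ p in U j ∩ Ω, F p := by
    intro j F hF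
    refine lintegral_segment_le hd (hψ j) (hSm j)
      ((hUo j).inter hΩ.isOpen).measurableSet ?_ ?_ hF
    · rintro p ⟨hp1, hp2⟩
      have := snd_eq_of_mem_frontier hΩ.isOpen (hUo j) (hψ j).continuous (hUΩ j) hp1
        (hp2 (Metric.mem_ball_self hε))
      refine ⟨(e j p).fst, ?_⟩
      rw [graphPoint, this, coordPoint_apply]
    · rintro p ⟨hp1, hp2⟩ s ⟨hs1, hs2⟩
      exact add_smul_vertical_mem hΩ.isOpen (hUo j) (hψ j).continuous (hUΩ j) hp1 hp2 hs1
        (hs2.trans_lt hδ)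
  calc ∫⁻ x, ‖u x‖ₑ ^ 2 ∂surfaceMeasure Ω
      ≤ ∑' j, ∫⁻ x in S j, ‖u x‖ₑ ^ 2 ∂Measure.euclideanHausdorffMeasure (d - 1) :=
        (lintegral_mono_set hsub).trans (lintegral_iUnion_le _ _)
    _ ≤ ∑' j, (((1 + M : ℝ≥0) : ℝ≥0∞) ^ (d - 1) *
          (ENNReal.ofReal (2 / δ) * (∫⁻ x in U j ∩ Ω, ‖u x‖ₑ ^ 2) +
          ENNReal.ofReal (2 * δ) * ∫⁻ x in U j ∩ Ω, ‖classicalGradient u x‖ₑ ^ 2)) := by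
        refine ENNReal.tsum_le_tsum fun j => ?_
        refine (lintegral_mono fun p => enorm_sq_le_lintegral_segment hu p
          (norm_vertical (e := e j)) h0).trans ?_
        rw [lintegral_add_left ((hmeas _ m1 _).const_mul _),
          lintegral_const_mul _ (hmeas _ m1 _), lintegral_const_mul _ (hmeas _ m2 _), mul_add,
          mul_left_comm, mul_left_comm _ (ENNReal.ofReal (2 * δ))]
        gcongr
        · exact piece j _ m1
        · exact piece j _ m2
    _ ≤ _ := by
        rw [ENNReal.tsum_mul_left, ENNReal.tsum_add, ENNReal.tsum_mul_left, ENNReal.tsum_mul_left]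
        push_cast
        rw [mul_assoc]
        gcongr
        rw [mul_add, mul_left_comm, mul_left_comm (N : ℝ≥0∞)]
        gcongr
        · exact tsum_setLIntegral_le (fun j => (hUo j).measurableSet) hN m1
        · exact tsum_setLIntegral_le (fun j => (hUo j).measurableSet) hN m2

end TraceInequality

/-! ### Mollification in `L²` -/

section Mollification

theorem eLpNorm_two_sq {α E : Type*} [MeasurableSpace α] [NormedAddCommGroup E] (f : α → E)
    (μ : Measure α) : eLpNorm f 2 μ ^ 2 = ∫⁻ x, ‖f x‖ₑ ^ 2 ∂μ := by
  have h := eLpNorm_nnreal_pow_eq_lintegral (f := f) (μ := μ) (p := 2) two_ne_zero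
  simpa using h

/-- Jensen's inequality for the square under the probability measure with density `w`. -/
theorem sq_lintegral_mul_le {α : Type*} [MeasurableSpace α] {μ : Measure α} {w h : α → ℝ≥0∞}
    (hw : Measurable w) (hh : Measurable h) (h1 : ∫⁻ a, w a ∂μ = 1) :
    (∫⁻ a, w a * h a ∂μ) ^ 2 ≤ ∫⁻ a, w a * h a ^ 2 ∂μ := by
  have e1 : ∀ g : α → ℝ≥0∞, Measurable g →
      ∫⁻ a, w a * g a ∂μ = ∫⁻ a, g a ∂(μ.withDensity w) := fun g hg => by
    rw [lintegral_withDensity_eq_lintegral_mul _ hw hg]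
    rfl
  rw [e1 h hh, e1 _ (hh.pow_const 2)]
  have h2 : (μ.withDensity w) Set.univ = 1 := by
    rw [withDensity_apply _ MeasurableSet.univ, Measure.restrict_univ, h1]
  have h3 := ENNReal.lintegral_mul_le_Lp_mul_Lq (μ.withDensity w) Real.HolderConjugate.two_two
    hh.aemeasurable (aemeasurable_const (b := (1 : ℝ≥0∞)))
  simp only [Pi.mul_apply, mul_one, lintegral_const, h2, ENNReal.rpow_ofNat] at h3
  calc _ ≤ _ := pow_le_pow_left' h3 2
    _ = _ := by
      rw [one_pow, ENNReal.one_rpow, mul_one, ← ENNReal.rpow_natCast, ← ENNReal.rpow_mul]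
      norm_num

variable {d : ℕ} {F : Type*} [NormedAddCommGroup F]

theorem tendsto_eLpNorm_translate_sub {g : Eucl d → F} (hg : MemLp g 2 volume) :
    Tendsto (fun z => eLpNorm (fun x => g (x - z) - g x) 2 volume) (𝓝 0) (𝓝 0) := by
  let τ : Eucl d → C(Eucl d, Eucl d) := fun z => ⟨fun x => x - z, by fun_prop⟩
  have hτ : Continuous τ :=
    (ContinuousMap.curry ⟨fun q : Eucl d × Eucl d => q.2 - q.1, by fun_prop⟩).continuous
  have hτm : ∀ z, MeasurePreserving (τ z) volume volume := fun z =>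
    measurePreserving_sub_right volume z
  have h := (continuous_const (y := hg.toLp g)).compMeasurePreservingLp hτ hτm (by simp)
  have h0 := (h.tendsto 0)
  have hid : Lp.compMeasurePreserving (τ 0) (hτm 0) (hg.toLp g) = hg.toLp g := by
    rw [Lp.toLp_compMeasurePreserving]
    congr 1
    ext x
    simp [τ]
  rw [hid] at h0
  simp only [Lp.toLp_compMeasurePreserving] at h0
  exact (Lp.tendsto_Lp_iff_tendsto_eLpNorm'' (fun z => g ∘ τ z)
    (fun z => hg.comp_measurePreserving (hτm z)) g hg).1 h0

variable [NormedSpace ℝ F]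

/-- The convolution `η * g`. -/
noncomputable def mollify (η : Eucl d → ℝ) (g : Eucl d → F) (x : Eucl d) : F :=
  ∫ t, η (x - t) • g t

theorem mollify_eq_convolution (η : Eucl d → ℝ) (g : Eucl d → F) :
    mollify η g = convolution g η (ContinuousLinearMap.lsmul ℝ ℝ).flip volume := rfl

theorem contDiff_mollify {η : Eucl d → ℝ} {g : Eucl d → F} (hη : ContDiff ℝ ∞ η)
    (hc : HasCompactSupport η) (hg : LocallyIntegrable g) : ContDiff ℝ ∞ (mollify η g) := by
  rw [mollify_eq_convolution]
  exact hc.contDiff_convolution_right _ hg hη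

theorem hasCompactSupport_mollify {η : Eucl d → ℝ} {g : Eucl d → F}
    (hc : HasCompactSupport η) (hg : HasCompactSupport g) : HasCompactSupport (mollify η g) := by
  rw [mollify_eq_convolution]
  exact hg.convolution _ hc

theorem partialDeriv_mollify {η : Eucl d → ℝ} {g : Eucl d → F} (hη : ContDiff ℝ ∞ η)
    (hc : HasCompactSupport η) (hg : LocallyIntegrable g) (i : Fin d) (x : Eucl d) :
    partialDeriv i (mollify η g) x = mollify (partialDeriv i η) g x := by
  have h := hc.hasFDerivAt_convolution_right (ContinuousLinearMap.lsmul ℝ ℝ).flip hg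
    (hη.of_le (by simp)) x
  rw [partialDeriv, mollify_eq_convolution, h.fderiv,
    convolution_precompR_apply _ hg (hc.fderiv (𝕜 := ℝ)) (hη.continuous_fderiv (by simp))]
  rfl

/-- The mollification error is an average, with weight η, of the translation errors g(x − z) − g(x).
Jensen and Tonelli bound its L² norm by the largest of theirs over the z where η does not vanish. -/
theorem eLpNorm_mollify_sub_le [CompleteSpace F] {η : Eucl d → ℝ} {g : Eucl d → F}
    (hη : Continuous η) (hc : HasCompactSupport η) (h0 : ∀ x, 0 ≤ η x) (h1 : ∫ x, η x = 1)
    (hg : MemLp g 2 volume) (hgm : StronglyMeasurable g) {r : ℝ≥0∞}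
    (hr : ∀ z, η z ≠ 0 → eLpNorm (fun x => g (x - z) - g x) 2 volume ≤ r) :
    eLpNorm (fun x => mollify η g x - g x) 2 volume ≤ r := by
  have hloc : LocallyIntegrable g := hg.locallyIntegrable one_le_two
  have hηi : Integrable η := hη.integrable_of_hasCompactSupport hc
  have hw : ∫⁻ z, ENNReal.ofReal (η z) = 1 := by
    rw [← ofReal_integral_eq_lintegral_ofReal hηi (ae_of_all _ h0), h1, ENNReal.ofReal_one]
  have hwm : Measurable fun z => ENNReal.ofReal (η z) := hη.measurable.ennreal_ofReal
  have hjm : StronglyMeasurable fun q : Eucl d × Eucl d => g (q.1 - q.2) - g q.1 :=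
    (hgm.comp_measurable (by fun_prop)).sub (hgm.comp_measurable measurable_fst)
  have hpt : ∀ x, ‖mollify η g x - g x‖ₑ ^ 2 ≤
      ∫⁻ z, ENNReal.ofReal (η z) * ‖g (x - z) - g x‖ₑ ^ 2 := by
    intro x
    have hconv : Integrable fun z => η z • g (x - z) := by
      have hx : Continuous fun t => η (x - t) := hη.comp (by fun_prop)
      have hxc : HasCompactSupport fun t => η (x - t) :=
        hc.comp_homeomorph (Homeomorph.subLeft x)
      have := (integrable_smul_of_test hg hx hxc).comp_sub_left x
      simpa using this
    have e1 : mollify η g x - g x = ∫ z, η z • (g (x - z) - g x) := by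
      have : mollify η g x = ∫ z, η z • g (x - z) := by
        rw [mollify, ← integral_sub_left_eq_self _ volume x]
        simp
      simp only [smul_sub]
      rw [integral_sub hconv (hηi.smul_const _), integral_smul_const, h1, one_smul, this]
    rw [e1]
    refine (pow_le_pow_left' (enorm_integral_le_lintegral_enorm _) 2).trans ?_
    have e2 : ∀ z, ‖η z • (g (x - z) - g x)‖ₑ =
        ENNReal.ofReal (η z) * ‖g (x - z) - g x‖ₑ := fun z => by
      rw [enorm_smul, Real.enorm_eq_ofReal (h0 z)]
    simp only [e2]
    exact sq_lintegral_mul_le hwm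
      (hjm.comp_measurable (measurable_prodMk_left (x := x))).enorm hw
  rw [← ENNReal.pow_le_pow_left_iff two_ne_zero, eLpNorm_two_sq]
  calc ∫⁻ x, ‖mollify η g x - g x‖ₑ ^ 2
      ≤ ∫⁻ x, ∫⁻ z, ENNReal.ofReal (η z) * ‖g (x - z) - g x‖ₑ ^ 2 := lintegral_mono hpt
    _ = ∫⁻ z, ∫⁻ x, ENNReal.ofReal (η z) * ‖g (x - z) - g x‖ₑ ^ 2 := by
        refine lintegral_lintegral_swap (Measurable.aemeasurable ?_)
        exact (hwm.comp measurable_snd).mul (hjm.enorm.pow_const 2)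
    _ ≤ ∫⁻ z, ENNReal.ofReal (η z) * r ^ 2 := by
        refine lintegral_mono fun z => ?_
        rw [lintegral_const_mul' _ _ ENNReal.ofReal_ne_top, ← eLpNorm_two_sq]
        by_cases hz : η z = 0
        · simp [hz]
        · gcongr
          exact hr z hz
    _ = r ^ 2 := by rw [lintegral_mul_const _ hwm, hw, one_mul]

end Mollification

/-! ### Directions pointing into the domain -/

section Cone

variable {d : ℕ}

/-- Inside `U`, the domain `Ω` contains with every point a cone of directions around `n`. -/
def HasInteriorCone (Ω U : Set (Eucl d)) (n : Eucl d) (c : ℝ) : Prop :=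
  ∀ x ∈ U ∩ Ω, ∀ τ : ℝ, 0 < τ → ∀ z ∈ U, ‖z - (x + τ • n)‖ < c * τ → z ∈ Ω

/-- Moving up by τ raises the height above the graph by τ, and a further displacement shorter than
τ/(1 + M) changes that height by less than τ. -/
theorem hasInteriorCone_of_eq_specialDomain {e : Eucl d ≃ᵢ WithLp 2 (Eucl (d - 1) × ℝ)}
    {ψ : Eucl (d - 1) → ℝ} {M : ℝ≥0} (hψ : LipschitzWith M ψ) {Ω U : Set (Eucl d)}
    (h : U ∩ Ω = U ∩ specialDomain e ψ) :
    HasInteriorCone Ω U (vertical e) (1 / (1 + M)) := by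
  intro x hx τ hτ z hz hzx
  suffices z ∈ U ∩ specialDomain e ψ by
    rw [← h] at this
    exact this.2
  refine ⟨hz, ?_⟩
  rw [h] at hx
  have hx2 : ψ (e x).fst < (e x).snd := hx.2
  have e1 : x + τ • vertical e = coordPoint e ((e x).fst, (e x).snd + τ) := by
    rw [coordPoint_add, coordPoint_apply]
  rw [e1, ← dist_eq_norm, ← e.dist_eq, apply_coordPoint, dist_eq_norm] at hzx
  have h1 := WithLp.norm_fst_le _ (e z - WithLp.toLp 2 ((e x).fst, (e x).snd + τ))
  have h2 := WithLp.norm_snd_le _ (e z - WithLp.toLp 2 ((e x).fst, (e x).snd + τ))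
  change ‖(e z).fst - (e x).fst‖ ≤ _ at h1
  change ‖(e z).snd - ((e x).snd + τ)‖ ≤ _ at h2
  have h3 := hψ.dist_le_mul (e z).fst (e x).fst
  rw [Real.dist_eq, dist_eq_norm] at h3
  rw [Real.norm_eq_abs] at h2
  have h4 := (abs_le.1 h2).1
  have h5 := (abs_le.1 h3).2
  have h6 : (M : ℝ) * ‖(e z).fst - (e x).fst‖ ≤ M * (1 / (1 + M) * τ) :=
    mul_le_mul_of_nonneg_left (h1.trans hzx.le) M.2
  have h7 : (M : ℝ) * (1 / (1 + M) * τ) + 1 / (1 + M) * τ = τ := by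
    have : (0 : ℝ) ≤ M := M.2
    field_simp
    ring
  change ψ (e z).fst < (e z).snd
  linarith

theorem IsLipschitzDomain.exists_hasInteriorCone {Ω : Set (Eucl d)} (hΩ : IsLipschitzDomain Ω)
    (p : Eucl d) :
    ∃ (U : Set (Eucl d)) (n : Eucl d) (c : ℝ), IsOpen U ∧ p ∈ U ∧ 0 < c ∧
      HasInteriorCone Ω U n c := by
  by_cases hp : p ∈ Ω
  -- Inside Ω the conclusion z ∈ Ω is immediate with `U = Ω`; outside the closure the condition is
  -- vacuous. Only boundary points need a chart.
  · exact ⟨Ω, 0, 1, hΩ.isOpen, hp, one_pos, fun _ _ _ _ z hz _ => hz⟩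
  by_cases hp' : p ∈ closure Ω
  · obtain ⟨ε, N, M, ι, _, U, hε, hUo, hcov, -, hchart⟩ := hΩ.exists_cover
    obtain ⟨j, hj⟩ := hcov p (by rw [hΩ.isOpen.frontier_eq]; exact ⟨hp', hp⟩)
    obtain ⟨e, ψ, hψ, hU⟩ := hchart j
    exact ⟨U j, vertical e, 1 / (1 + M), hUo j, hj (Metric.mem_ball_self hε), by positivity,
      hasInteriorCone_of_eq_specialDomain hψ hU⟩
  · exact ⟨(closure Ω)ᶜ, 0, 1, isClosed_closure.isOpen_compl, hp', one_pos,
      fun x hx => absurd (subset_closure hx.2) hx.1⟩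

end Cone

/-! ### Density of test functions in `H¹(Ω)` -/

section Density

variable {d : ℕ} {Ω : Set (Eucl d)}

/-- The pair `(f, G)` can be approximated in `L²(Ω)` by test functions and their gradients. -/
def Approximable (Ω : Set (Eucl d)) (f : Eucl d → ℂ) (G : Eucl d → EuclideanSpace ℂ (Fin d)) :
    Prop :=
  ∀ ε : ℝ≥0∞, ε ≠ 0 → ∃ u, IsTest u ∧
    eLpNorm (fun x => u x - f x) 2 (volume.restrict Ω) ≤ ε ∧
    eLpNorm (fun x => classicalGradient u x - G x) 2 (volume.restrict Ω) ≤ ε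

/-- The gradient of `χ f`, for `f` with gradient `G`. -/
noncomputable def cutoffGradient (χ : Eucl d → ℝ) (f : Eucl d → ℂ)
    (G : Eucl d → EuclideanSpace ℂ (Fin d)) (x : Eucl d) : EuclideanSpace ℂ (Fin d) :=
  χ x • G x + f x • classicalGradient (fun y => (χ y : ℂ)) x

theorem partialDeriv_ofReal {χ : Eucl d → ℝ} (h : ContDiff ℝ ∞ χ) (i : Fin d) (x : Eucl d) :
    partialDeriv i (fun y => (χ y : ℂ)) x = ((partialDeriv i χ x : ℝ) : ℂ) := by
  have h1 := Complex.ofRealCLM.hasFDerivAt.comp x (h.differentiable (by simp) x).hasFDerivAt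
  have h2 : HasFDerivAt (fun y => (χ y : ℂ)) (Complex.ofRealCLM ∘L fderiv ℝ χ x) x := h1
  rw [partialDeriv, h2.fderiv]
  rfl

theorem cutoffGradient_apply {χ : Eucl d → ℝ} (h : ContDiff ℝ ∞ χ) (f : Eucl d → ℂ)
    (G : Eucl d → EuclideanSpace ℂ (Fin d)) (x : Eucl d) (i : Fin d) :
    cutoffGradient χ f G x i = χ x • G x i + partialDeriv i χ x • f x := by
  rw [cutoffGradient, PiLp.add_apply, PiLp.smul_apply, PiLp.smul_apply]
  simp only [classicalGradient, partialDeriv_ofReal h]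
  rw [smul_eq_mul, Complex.real_smul (x := partialDeriv i χ x), mul_comm (f x)]

theorem isTest_ofReal {χ : Eucl d → ℝ} (h : ContDiff ℝ ∞ χ) (hc : HasCompactSupport χ) :
    IsTest fun x => (χ x : ℂ) :=
  ⟨Complex.ofRealCLM.contDiff.comp h, hc.comp_left (g := Complex.ofReal) Complex.ofReal_zero⟩

theorem memLp_smul_of_bounded {E : Type*} [NormedAddCommGroup E] [NormedSpace ℝ E]
    {μ : Measure (Eucl d)} {f : Eucl d → E} (hf : MemLp f 2 μ) {χ : Eucl d → ℝ}
    (h : Continuous χ) (hc : HasCompactSupport χ) : MemLp (fun x => χ x • f x) 2 μ := by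
  obtain ⟨C, hC⟩ := hc.exists_bound_of_continuous h
  refine MemLp.of_le_mul hf (h.aestronglyMeasurable.smul hf.1) (c := C) (ae_of_all _ fun x => ?_)
  rw [norm_smul]
  exact mul_le_mul_of_nonneg_right (hC x) (norm_nonneg _)

theorem memLp_cutoffGradient {μ : Measure (Eucl d)} {f : Eucl d → ℂ}
    {G : Eucl d → EuclideanSpace ℂ (Fin d)} (hf : MemLp f 2 μ) (hG : MemLp G 2 μ)
    {χ : Eucl d → ℝ} (h : ContDiff ℝ ∞ χ) (hc : HasCompactSupport χ) :
    MemLp (cutoffGradient χ f G) 2 μ := by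
  have hu := isTest_ofReal h hc
  have c1 := continuous_classicalGradient hu.1
  obtain ⟨C, hC⟩ := (hasCompactSupport_classicalGradient hu.2).exists_bound_of_continuous c1
  refine (memLp_smul_of_bounded hG h.continuous hc).add ?_
  refine MemLp.of_le_mul hf (hf.1.smul c1.aestronglyMeasurable) (c := C) (ae_of_all _ fun x => ?_)
  rw [norm_smul, mul_comm]
  exact mul_le_mul_of_nonneg_right (hC x) (norm_nonneg _)

/-- The kernel sits near −τn, so convolution with it samples a function near x + τn, inside the
cone. The outer radius cτ/2 leaves room for the strict bound on the closed support. -/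
theorem exists_kernel {n : Eucl d} {c τ : ℝ} (hc : 0 < c) (hτ : 0 < τ) :
    ∃ η : Eucl d → ℝ, ContDiff ℝ ∞ η ∧ HasCompactSupport η ∧ (∀ z, 0 ≤ η z) ∧ ∫ z, η z = 1 ∧
      ∀ z ∈ tsupport η, ‖z + τ • n‖ < c * τ := by
  have hcτ : 0 < c * τ := mul_pos hc hτ
  let b : ContDiffBump (0 : Eucl d) := ⟨c * τ / 4, c * τ / 2, by positivity, by linarith⟩
  refine ⟨fun z => b.normed volume (z + τ • n), b.contDiff_normed.comp (by fun_prop),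
    b.hasCompactSupport_normed.comp_homeomorph (Homeomorph.addRight (τ • n)),
    fun z => b.nonneg_normed _, ?_, fun z hz => ?_⟩
  · rw [integral_add_right_eq_self (fun z => b.normed volume z), b.integral_normed]
  · have hcl : IsClosed {z : Eucl d | ‖z + τ • n‖ ≤ c * τ / 2} :=
      isClosed_le (by fun_prop) continuous_const
    have hz' : z ∈ {z : Eucl d | ‖z + τ • n‖ ≤ c * τ / 2} := by
      refine closure_minimal (fun y hy => ?_) hcl hz
      have hy' : y + τ • n ∈ Function.support (b.normed volume) := hy
      rw [b.support_normed_eq, mem_ball_zero_iff] at hy'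
      exact hy'.le
    exact lt_of_le_of_lt hz' (by linarith)

/-- Extension by zero may create a jump across ∂Ω, so mollification and gradient do not commute
everywhere. At this x they do: t ↦ η(x − t) meets the support of χ only inside Ω, so the cut-off
product rule may be tested against it. -/
theorem IsWeakGradient.classicalGradient_mollify {f : L2 Ω} {G : L2Vec Ω}
    (hΩ : IsOpen Ω) (h : IsWeakGradient Ω f G) {χ η : Eucl d → ℝ} (hχ : ContDiff ℝ ∞ χ)
    (hχc : HasCompactSupport χ) (hη : ContDiff ℝ ∞ η) (hηc : HasCompactSupport η) {x : Eucl d}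
    (hx : ∀ y, x - y ∈ tsupport η → y ∈ tsupport χ → y ∈ Ω) :
    classicalGradient (mollify η (Ω.indicator fun y => χ y • f y)) x =
      mollify η (Ω.indicator (cutoffGradient χ f G)) x := by
  have hg : MemLp (Ω.indicator fun y => χ y • f y) 2 volume :=
    (memLp_indicator_iff_restrict hΩ.measurableSet).2
      (memLp_smul_of_bounded (Lp.memLp f) hχ.continuous hχc)
  have hΓ : MemLp (Ω.indicator (cutoffGradient χ f G)) 2 volume :=
    (memLp_indicator_iff_restrict hΩ.measurableSet).2
      (memLp_cutoffGradient (Lp.memLp f) (Lp.memLp G) hχ hχc)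
  have hφ : ContDiff ℝ ∞ fun t => η (x - t) := hη.comp (by fun_prop)
  have hφc : HasCompactSupport fun t => η (x - t) := hηc.comp_homeomorph (Homeomorph.subLeft x)
  have hφs : tsupport (fun t => η (x - t)) ∩ tsupport χ ⊆ Ω := by
    rintro y ⟨hy1, hy2⟩
    refine hx y ?_ hy2
    exact tsupport_comp_subset_preimage η (f := fun t => x - t) (by fun_prop) hy1
  have hφd : ∀ i t, partialDeriv i (fun t => η (x - t)) t = -partialDeriv i η (x - t) := by
    intro i t
    have h1 : HasFDerivAt (fun t => η (x - t)) (fderiv ℝ η (x - t) ∘L (-ContinuousLinearMap.id ℝ _))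
        t := (hη.differentiable (by simp) (x - t)).hasFDerivAt.comp t
          ((hasFDerivAt_id t).const_sub x)
    rw [partialDeriv, h1.fderiv]
    simp [partialDeriv]
  ext i
  have key := h.integral_cutoff hχ hφ hφc hφs i
  simp only [hφd, neg_smul, integral_neg, neg_inj] at key
  have e1 : classicalGradient (mollify η (Ω.indicator fun y => χ y • f y)) x i =
      ∫ t in Ω, partialDeriv i η (x - t) • (χ t • f t) := by
    change partialDeriv i (mollify η (Ω.indicator fun y => χ y • f y)) x = _
    rw [partialDeriv_mollify hη hηc (hg.locallyIntegrable one_le_two), mollify,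
      ← integral_indicator hΩ.measurableSet]
    refine integral_congr_ae (ae_of_all _ fun t => ?_)
    by_cases ht : t ∈ Ω <;> simp [ht]
  have e2 : mollify η (Ω.indicator (cutoffGradient χ f G)) x i =
      ∫ t in Ω, η (x - t) • (χ t • G t i + partialDeriv i χ t • f t) := by
    have hint := integrable_smul_of_test hΓ hφ.continuous hφc
    have h2 := (EuclideanSpace.proj i : EuclideanSpace ℂ (Fin d) →L[ℂ] ℂ).integral_comp_comm hint
    change (EuclideanSpace.proj i : EuclideanSpace ℂ (Fin d) →L[ℂ] ℂ) _ = _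
    rw [mollify, ← h2, ← integral_indicator hΩ.measurableSet]
    refine integral_congr_ae (ae_of_all _ fun t => ?_)
    by_cases ht : t ∈ Ω
    · simp only [Set.indicator_of_mem ht, ← cutoffGradient_apply hχ]
      simp
    · simp [ht]
  rw [e1, e2, key]

/-- Mollify the zero extensions of the cut-off function and of its gradient with the kernel shifted
into the cone. At points of Ω the second is the gradient of the first, and both converge in L² by
continuity of translations. -/
theorem IsWeakGradient.approximable_cutoff_of_cone {f : L2 Ω} {G : L2Vec Ω}
    (hΩ : IsOpen Ω) (h : IsWeakGradient Ω f G) {U : Set (Eucl d)} {n : Eucl d} {c : ℝ}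
    (hU : IsOpen U) (hc : 0 < c) (hcone : HasInteriorCone Ω U n c) {χ : Eucl d → ℝ}
    (hχ : ContDiff ℝ ∞ χ) (hχc : HasCompactSupport χ) (hχU : tsupport χ ⊆ U) :
    Approximable Ω (fun x => χ x • f x) (cutoffGradient χ f G) := by
  intro ε hε
  set g := Ω.indicator fun y => χ y • f y with hgdef
  set Γ := Ω.indicator (cutoffGradient χ f G) with hΓdef
  have hg : MemLp g 2 volume := (memLp_indicator_iff_restrict hΩ.measurableSet).2
      (memLp_smul_of_bounded (Lp.memLp f) hχ.continuous hχc)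
  have hΓ : MemLp Γ 2 volume := (memLp_indicator_iff_restrict hΩ.measurableSet).2
      (memLp_cutoffGradient (Lp.memLp f) (Lp.memLp G) hχ hχc)
  have hgm : StronglyMeasurable g :=
    (hχ.continuous.stronglyMeasurable.smul (Lp.stronglyMeasurable f)).indicator hΩ.measurableSet
  have hΓm : StronglyMeasurable Γ :=
    ((hχ.continuous.stronglyMeasurable.smul (Lp.stronglyMeasurable G)).add
      ((Lp.stronglyMeasurable f).smul
        (continuous_classicalGradient (isTest_ofReal hχ hχc).1).stronglyMeasurable)).indicator
          hΩ.measurableSet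
  have hgc : HasCompactSupport g := by
    refine hχc.mono' fun x hx => subset_tsupport χ fun hx' => hx ?_
    by_cases hxΩ : x ∈ Ω <;> simp [hgdef, hxΩ, hx']
  have hev := ((tendsto_eLpNorm_translate_sub hg).eventually
    (Iic_mem_nhds (pos_iff_ne_zero.2 hε))).and
    ((tendsto_eLpNorm_translate_sub hΓ).eventually (Iic_mem_nhds (pos_iff_ne_zero.2 hε)))
  obtain ⟨ρ, hρ, hρε⟩ := Metric.eventually_nhds_iff.1 hev
  obtain ⟨r, hr, hrU⟩ := IsCompact.exists_cthickening_subset_open hχc hU hχU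
  have hK : 0 < ‖n‖ + c := by positivity
  -- The kernel lives in the ball of radius τ(‖n‖ + c). Below ρ its translations cost at most ε;
  -- below r any x in Ω from which it reaches the support of χ lies in `U`, where the cone condition
  -- applies.
  set τ := min ρ r / (2 * (‖n‖ + c)) with hτdef
  have hτ : 0 < τ := by positivity
  have hτK : τ * (‖n‖ + c) < min ρ r := by
    have : τ * (‖n‖ + c) = min ρ r / 2 := by
      rw [hτdef]
      field_simp
    rw [this]
    exact half_lt_self (lt_min hρ hr)
  obtain ⟨η, hη, hηc, hη0, hη1, hηs⟩ := exists_kernel (n := n) hc hτ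
  have hηn : ∀ z ∈ tsupport η, ‖z‖ < min ρ r := fun z hz => by
    have h1 := hηs z hz
    have h2 := norm_sub_le (z + τ • n) (τ • n)
    rw [add_sub_cancel_right, norm_smul, Real.norm_eq_abs, abs_of_pos hτ] at h2
    linarith
  have hb : ∀ z, η z ≠ 0 → dist z 0 < ρ := fun z hz => by
    rw [dist_zero_right]
    exact (hηn z (subset_tsupport η hz)).trans_le (min_le_left _ _)
  refine ⟨mollify η g, ⟨contDiff_mollify hη hηc (hg.locallyIntegrable one_le_two),
    hasCompactSupport_mollify hηc hgc⟩, ?_, ?_⟩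
  · have h1 := eLpNorm_mollify_sub_le hη.continuous hηc hη0 hη1 hg hgm
      (fun z hz => (hρε (hb z hz)).1)
    refine le_trans (le_of_eq ?_)
      ((eLpNorm_mono_measure _ (Measure.restrict_le_self (s := Ω))).trans h1)
    refine eLpNorm_congr_ae ?_
    filter_upwards [ae_restrict_mem hΩ.measurableSet] with x hx
    simp [hgdef, hx]
  · have h1 := eLpNorm_mollify_sub_le hη.continuous hηc hη0 hη1 hΓ hΓm
      (fun z hz => (hρε (hb z hz)).2)
    refine le_trans (le_of_eq ?_)
      ((eLpNorm_mono_measure _ (Measure.restrict_le_self (s := Ω))).trans h1)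
    refine eLpNorm_congr_ae ?_
    filter_upwards [ae_restrict_mem hΩ.measurableSet] with x hx
    rw [hgdef, h.classicalGradient_mollify hΩ hχ hχc hη hηc, ← hΓdef, hΓdef,
      Set.indicator_of_mem hx]
    intro y hy1 hy2
    have hxU : x ∈ U := hrU (Metric.mem_cthickening_of_dist_le x y r _ hy2 (by
      rw [dist_eq_norm]
      exact ((hηn _ hy1).trans_le (min_le_right _ _)).le))
    refine hcone x ⟨hxU, hx⟩ τ hτ y (hχU hy2) ?_
    have e : y - (x + τ • n) = -(x - y + τ • n) := by abel
    rw [e, norm_neg]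
    exact hηs _ hy1

theorem Approximable.add {f f' : Eucl d → ℂ} {G G' : Eucl d → EuclideanSpace ℂ (Fin d)}
    (h : Approximable Ω f G) (h' : Approximable Ω f' G') (hf : MemLp f 2 (volume.restrict Ω))
    (hf' : MemLp f' 2 (volume.restrict Ω)) (hG : MemLp G 2 (volume.restrict Ω))
    (hG' : MemLp G' 2 (volume.restrict Ω)) :
    Approximable Ω (f + f') (G + G') := by
  intro ε hε
  obtain ⟨u, hu, h1, h2⟩ := h (ε / 2) (by simpa using hε)
  obtain ⟨v, hv, h3, h4⟩ := h' (ε / 2) (by simpa using hε)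
  refine ⟨u + v, hu.add hv, ?_, ?_⟩
  · rw [← ENNReal.add_halves ε]
    refine le_trans (le_of_eq ?_) ((eLpNorm_add_le (hu.memLp.1.sub hf.1) (hv.memLp.1.sub hf'.1)
      one_le_two).trans (add_le_add h1 h3))
    congr 1
    ext x
    simp only [Pi.add_apply, Pi.sub_apply]
    ring
  · rw [← ENNReal.add_halves ε]
    refine le_trans (le_of_eq ?_) ((eLpNorm_add_le (hu.memLp_gradient.1.sub hG.1)
      (hv.memLp_gradient.1.sub hG'.1) one_le_two).trans (add_le_add h2 h4))
    congr 1
    rw [classicalGradient_add hu hv]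
    ext x : 1
    simp only [Pi.add_apply, Pi.sub_apply]
    abel

theorem approximable_zero : Approximable Ω 0 0 := fun ε _ =>
  ⟨0, ⟨contDiff_const, HasCompactSupport.zero⟩, by simp, by
    have : classicalGradient (0 : Eucl d → ℂ) = 0 := by
      ext x i
      simp [classicalGradient, partialDeriv]
    simp [this]⟩

theorem cutoffGradient_zero (f : Eucl d → ℂ) (G : Eucl d → EuclideanSpace ℂ (Fin d)) :
    cutoffGradient (fun _ => 0) f G = 0 := by
  ext x i
  simp [cutoffGradient, classicalGradient, partialDeriv]

theorem cutoffGradient_add {χ χ' : Eucl d → ℝ} (h : ContDiff ℝ ∞ χ) (h' : ContDiff ℝ ∞ χ')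
    (f : Eucl d → ℂ) (G : Eucl d → EuclideanSpace ℂ (Fin d)) :
    cutoffGradient (fun x => χ x + χ' x) f G = cutoffGradient χ f G + cutoffGradient χ' f G := by
  ext x i
  rw [Pi.add_apply, PiLp.add_apply, cutoffGradient_apply (h.add h'), cutoffGradient_apply h,
    cutoffGradient_apply h']
  have : partialDeriv i (fun x => χ x + χ' x) x = partialDeriv i χ x + partialDeriv i χ' x := by
    rw [partialDeriv, fderiv_fun_add (h.differentiable (by simp) x) (h'.differentiable (by simp) x)]
    rfl
  rw [this, add_smul, add_smul]
  abel

theorem approximable_cutoff_sum {ι : Type*} (s : Finset ι) {χ : ι → Eucl d → ℝ} {f : L2 Ω}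
    {G : L2Vec Ω} (h : ∀ i, ContDiff ℝ ∞ (χ i)) (hc : ∀ i, HasCompactSupport (χ i))
    (ha : ∀ i, Approximable Ω (fun x => χ i x • f x) (cutoffGradient (χ i) f G)) :
    Approximable Ω (fun x => (∑ i ∈ s, χ i x) • f x)
      (cutoffGradient (fun x => ∑ i ∈ s, χ i x) f G) := by
  classical
  have hsm : ∀ s : Finset ι, ContDiff ℝ ∞ fun x => ∑ i ∈ s, χ i x := fun s =>
    ContDiff.sum fun i _ => h i
  have hcs : ∀ s : Finset ι, HasCompactSupport fun x => ∑ i ∈ s, χ i x := by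
    intro s
    induction s using Finset.induction_on with
    | empty =>
      simp only [Finset.sum_empty]
      exact HasCompactSupport.zero
    | insert i s hi ih =>
      simp only [Finset.sum_insert hi]
      exact (hc i).add ih
  induction s using Finset.induction_on with
  | empty =>
    simp only [Finset.sum_empty, zero_smul, cutoffGradient_zero]
    exact approximable_zero
  | insert i s hi ih =>
    simp only [Finset.sum_insert hi, add_smul]
    rw [cutoffGradient_add (h i) (hsm s)]
    exact (ha i).add ih (memLp_smul_of_bounded (Lp.memLp f) (h i).continuous (hc i))
      (memLp_smul_of_bounded (Lp.memLp f) (hsm s).continuous (hcs s))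
      (memLp_cutoffGradient (Lp.memLp f) (Lp.memLp G) (h i) (hc i))
      (memLp_cutoffGradient (Lp.memLp f) (Lp.memLp G) (hsm s) (hcs s))

open scoped Manifold in
-- Compactness yields a finite cover; multiplying a partition of unity on the support of χ by χ
-- makes the sum correct everywhere.
theorem exists_partition_of_compactSupport {χ : Eucl d → ℝ} (hχ : ContDiff ℝ ∞ χ)
    (hχc : HasCompactSupport χ) {U : Eucl d → Set (Eucl d)} (hU : ∀ p, IsOpen (U p))
    (hpU : ∀ p, p ∈ U p) :
    ∃ (t : Finset (Eucl d)) (θ : t → Eucl d → ℝ), (∀ p, ContDiff ℝ ∞ (θ p)) ∧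
      (∀ p, HasCompactSupport (θ p)) ∧ (∀ p, tsupport (θ p) ⊆ U p) ∧
      ∀ x, ∑ p, θ p x = χ x := by
  obtain ⟨t, ht⟩ := IsCompact.elim_finite_subcover hχc U hU fun x _ => Set.mem_iUnion.2 ⟨x, hpU x⟩
  obtain ⟨ρ, hρ⟩ := SmoothPartitionOfUnity.exists_isSubordinate 𝓘(ℝ, Eucl d)
    (isClosed_tsupport χ) (fun p : t => U p) (fun p => hU p) (by
      intro x hx
      obtain ⟨p, hp, hxp⟩ := Set.mem_iUnion₂.1 (ht hx)
      exact Set.mem_iUnion.2 ⟨⟨p, hp⟩, hxp⟩)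
  refine ⟨t, fun p x => ρ p x * χ x, fun p => (ρ p).contMDiff.contDiff.mul hχ,
    fun p => hχc.mul_left, fun p => ?_, fun x => ?_⟩
  · exact (tsupport_mul_subset_left (f := ρ p) (g := χ)).trans (hρ p)
  · rw [← Finset.sum_mul]
    by_cases hx : x ∈ tsupport χ
    · have := ρ.sum_eq_one hx
      rw [finsum_eq_sum_of_fintype] at this
      rw [this, one_mul]
    · rw [image_eq_zero_of_notMem_tsupport hx, mul_zero]

theorem IsLipschitzDomain.approximable_cutoff (hΩ : IsLipschitzDomain Ω) {f : L2 Ω}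
    {G : L2Vec Ω} (h : IsWeakGradient Ω f G) {χ : Eucl d → ℝ} (hχ : ContDiff ℝ ∞ χ)
    (hχc : HasCompactSupport χ) :
    Approximable Ω (fun x => χ x • f x) (cutoffGradient χ f G) := by
  choose U n c hU hpU hc hcone using hΩ.exists_hasInteriorCone
  obtain ⟨t, θ, h1, h2, h3, h4⟩ := exists_partition_of_compactSupport hχ hχc hU hpU
  have := approximable_cutoff_sum Finset.univ h1 h2 fun p =>
    h.approximable_cutoff_of_cone hΩ.isOpen (hU p) (hc p) (hcone p) (h1 p) (h2 p) (h3 p)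
  simpa only [h4] using this

theorem tendsto_eLpNorm_of_dominated {E : Type*} [NormedAddCommGroup E] {μ : Measure (Eucl d)}
    {h : ℕ → Eucl d → E} {H : Eucl d → ℝ} (hm : ∀ k, AEStronglyMeasurable (h k) μ)
    (hH : MemLp H 2 μ) (hb : ∀ k x, ‖h k x‖ ≤ H x)
    (hlim : ∀ x, Tendsto (fun k => h k x) atTop (𝓝 0)) :
    Tendsto (fun k => eLpNorm (h k) 2 μ) atTop (𝓝 0) := by
  have h1 : Tendsto (fun k => ∫⁻ x, ‖h k x‖ₑ ^ 2 ∂μ) atTop (𝓝 (∫⁻ x, 0 ∂μ)) := by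
    refine tendsto_lintegral_of_dominated_convergence' (fun x => ‖H x‖ₑ ^ 2)
      (fun k => (hm k).enorm.pow_const 2) (fun k => ae_of_all _ fun x => ?_) ?_
      (ae_of_all _ fun x => ?_)
    · refine pow_le_pow_left' ?_ 2
      rw [← ofReal_norm, ← ofReal_norm]
      exact ENNReal.ofReal_le_ofReal ((hb k x).trans (le_abs_self _))
    · rw [← eLpNorm_two_sq]
      exact ENNReal.pow_ne_top hH.2.ne
    · have := (ENNReal.continuous_pow 2).tendsto _ |>.comp ((hlim x).enorm)
      simpa [Function.comp_def] using this
  simp only [lintegral_zero, ← eLpNorm_two_sq] at h1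
  have h2 := (ENNReal.continuous_rpow_const (y := (1 / 2 : ℝ))).tendsto _ |>.comp h1
  rw [ENNReal.zero_rpow_of_pos (by norm_num)] at h2
  refine h2.congr fun k => ?_
  simp only [Function.comp_apply]
  rw [← ENNReal.rpow_natCast, ← ENNReal.rpow_mul]
  norm_num

/-- A sequence of cutoff functions that exhausts the space. -/
theorem exists_cutoff_sequence (d : ℕ) :
    ∃ (χ : ℕ → Eucl d → ℝ) (C : ℝ), (∀ k, ContDiff ℝ ∞ (χ k)) ∧ (∀ k, HasCompactSupport (χ k)) ∧
      (∀ k x, |χ k x| ≤ 1) ∧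
      (∀ k x, ‖classicalGradient (fun y => (χ k y : ℂ)) x‖ ≤ C) ∧
      ∀ x, ∀ᶠ k in atTop, χ k x = 1 ∧ classicalGradient (fun y => (χ k y : ℂ)) x = 0 := by
  let b : ContDiffBump (0 : Eucl d) := ⟨1, 2, one_pos, one_lt_two⟩
  have hb : IsTest fun y => ((b y : ℝ) : ℂ) := isTest_ofReal b.contDiff b.hasCompactSupport
  obtain ⟨C, hC⟩ := (hasCompactSupport_classicalGradient hb.2).exists_bound_of_continuous
    (continuous_classicalGradient hb.1)
  have hpos : ∀ k : ℕ, (0 : ℝ) < (k + 1 : ℝ)⁻¹ := fun k => by positivity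
  have hgrad : ∀ (k : ℕ) (x : Eucl d),
      classicalGradient (fun y => ((b ((k + 1 : ℝ)⁻¹ • y) : ℝ) : ℂ)) x =
        (k + 1 : ℝ)⁻¹ • classicalGradient (fun y => ((b y : ℝ) : ℂ)) ((k + 1 : ℝ)⁻¹ • x) := by
    intro k x
    ext i
    have h1 := ((hb.1.differentiable (by simp) ((k + 1 : ℝ)⁻¹ • x)).hasFDerivAt).comp x
      ((hasFDerivAt_id x).const_smul (k + 1 : ℝ)⁻¹)
    have h2 : HasFDerivAt (fun y => ((b ((k + 1 : ℝ)⁻¹ • y) : ℝ) : ℂ)) _ x := h1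
    simp only [classicalGradient, partialDeriv, PiLp.smul_apply]
    rw [h2.fderiv]
    simp
  refine ⟨fun k x => b ((k + 1 : ℝ)⁻¹ • x), C, fun k => b.contDiff.comp (by fun_prop), fun k => ?_,
    fun k x => ?_, fun k x => ?_, fun x => ?_⟩
  · exact b.hasCompactSupport.comp_homeomorph (Homeomorph.smulOfNeZero _ (hpos k).ne')
  · rw [abs_of_nonneg b.nonneg]
    exact b.le_one
  · rw [hgrad, norm_smul, Real.norm_eq_abs, abs_of_pos (hpos k)]
    have h1 : (k + 1 : ℝ)⁻¹ ≤ 1 := inv_le_one_of_one_le₀ (by linarith [k.cast_nonneg (α := ℝ)])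
    have h2 := hC ((k + 1 : ℝ)⁻¹ • x)
    have h3 := norm_nonneg (classicalGradient (fun y => ((b y : ℝ) : ℂ)) ((k + 1 : ℝ)⁻¹ • x))
    nlinarith [(hpos k).le]
  · obtain ⟨K, hK⟩ := exists_nat_gt ‖x‖
    filter_upwards [eventually_ge_atTop K] with k hk
    have hlt : ‖x‖ < k + 1 := by
      have : (K : ℝ) ≤ k := by exact_mod_cast hk
      linarith
    have hmem : (k + 1 : ℝ)⁻¹ • x ∈ Metric.ball (0 : Eucl d) 1 := by
      rw [mem_ball_zero_iff, norm_smul, Real.norm_eq_abs, abs_of_pos (hpos k),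
        inv_mul_lt_iff₀ (by positivity), mul_one]
      exact hlt
    have hev : (fun y => ((b y : ℝ) : ℂ)) =ᶠ[𝓝 ((k + 1 : ℝ)⁻¹ • x)] fun _ => 1 := by
      filter_upwards [Metric.isOpen_ball.mem_nhds hmem] with y hy
      rw [b.one_of_mem_closedBall (Metric.ball_subset_closedBall hy), Complex.ofReal_one]
    refine ⟨b.one_of_mem_closedBall (Metric.ball_subset_closedBall hmem), ?_⟩
    rw [hgrad]
    have : classicalGradient (fun y => ((b y : ℝ) : ℂ)) ((k + 1 : ℝ)⁻¹ • x) = 0 := by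
      ext i
      simp only [classicalGradient, partialDeriv]
      rw [hev.fderiv_eq]
      simp
    rw [this, smul_zero]

/-- Cutoffs with uniformly bounded gradients reduce to compact support: both errors vanish by
dominated convergence, with majorants 2|f| and 2|G| + C|f|. -/
theorem IsLipschitzDomain.approximable (hΩ : IsLipschitzDomain Ω) {f : L2 Ω} {G : L2Vec Ω}
    (h : IsWeakGradient Ω f G) : Approximable Ω f G := by
  intro ε hε
  obtain ⟨χ, C, h1, h2, h3, h4, h5⟩ := exists_cutoff_sequence d
  have cg : ∀ k, Continuous (classicalGradient fun y => (χ k y : ℂ)) := fun k =>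
    continuous_classicalGradient (isTest_ofReal (h1 k) (h2 k)).1
  have t1 : Tendsto (fun k => eLpNorm (fun x => χ k x • f x - f x) 2 (volume.restrict Ω)) atTop
      (𝓝 0) := by
    refine tendsto_eLpNorm_of_dominated (H := fun x => 2 * ‖f x‖)
      (fun k => ((h1 k).continuous.aestronglyMeasurable.smul (Lp.aestronglyMeasurable f)).sub
        (Lp.aestronglyMeasurable f)) ((Lp.memLp f).norm.const_mul 2) (fun k x => ?_) fun x => ?_
    · refine (norm_sub_le _ _).trans ?_
      rw [norm_smul, Real.norm_eq_abs]
      nlinarith [h3 k x, norm_nonneg (f x)]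
    · refine tendsto_const_nhds.congr' ?_
      filter_upwards [h5 x] with k hk
      rw [hk.1, one_smul, sub_self]
  have t2 : Tendsto (fun k => eLpNorm (fun x => cutoffGradient (χ k) f G x - G x) 2
      (volume.restrict Ω)) atTop (𝓝 0) := by
    refine tendsto_eLpNorm_of_dominated (H := fun x => 2 * ‖G x‖ + C * ‖f x‖)
      (fun k => ((memLp_cutoffGradient (Lp.memLp f) (Lp.memLp G) (h1 k) (h2 k)).1).sub
        (Lp.aestronglyMeasurable G))
      (((Lp.memLp G).norm.const_mul 2).add ((Lp.memLp f).norm.const_mul C)) (fun k x => ?_)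
      fun x => ?_
    · refine (norm_sub_le _ _).trans ?_
      have e1 := norm_add_le (χ k x • G x) (f x • classicalGradient (fun y => (χ k y : ℂ)) x)
      rw [norm_smul, norm_smul, Real.norm_eq_abs] at e1
      rw [cutoffGradient]
      nlinarith [h3 k x, norm_nonneg (f x), norm_nonneg (G x), h4 k x]
    · refine tendsto_const_nhds.congr' ?_
      filter_upwards [h5 x] with k hk
      rw [cutoffGradient, hk.1, hk.2, one_smul, smul_zero, add_zero, sub_self]
  have hε2 : 0 < ε / 2 := pos_iff_ne_zero.2 (by simpa using hε)
  obtain ⟨k, hk1, hk2⟩ := ((t1.eventually (Iic_mem_nhds hε2)).and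
    (t2.eventually (Iic_mem_nhds hε2))).exists
  obtain ⟨u, hu, hu1, hu2⟩ := hΩ.approximable_cutoff h (h1 k) (h2 k) (ε / 2) hε2.ne'
  refine ⟨u, hu, ?_, ?_⟩
  · rw [← ENNReal.add_halves ε]
    refine le_trans (le_of_eq ?_) ((eLpNorm_add_le (f := fun x => u x - χ k x • f x)
      (g := fun x => χ k x • f x - f x) (hu.memLp.1.sub
        ((h1 k).continuous.aestronglyMeasurable.smul (Lp.aestronglyMeasurable f)))
      (((h1 k).continuous.aestronglyMeasurable.smul (Lp.aestronglyMeasurable f)).sub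
        (Lp.aestronglyMeasurable f)) one_le_two).trans (add_le_add hu1 hk1))
    congr 1
    ext x
    simp
  · have hm := (memLp_cutoffGradient (Lp.memLp f) (Lp.memLp G) (h1 k) (h2 k)).1
    rw [← ENNReal.add_halves ε]
    refine le_trans (le_of_eq ?_) ((eLpNorm_add_le
      (f := fun x => classicalGradient u x - cutoffGradient (χ k) f G x)
      (g := fun x => cutoffGradient (χ k) f G x - G x) (hu.memLp_gradient.1.sub hm)
      (hm.sub (Lp.aestronglyMeasurable G)) one_le_two).trans (add_le_add hu2 hk2))
    congr 1
    ext x : 1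
    simp

end Density

/-! ### The trace map -/

section Trace

variable {d : ℕ} {Ω : Set (Eucl d)}

theorem IsLipschitzDomain.exists_eLpNorm_trace_bound (hd : 1 ≤ d) (hΩ : IsLipschitzDomain Ω) :
    ∃ (ε : ℝ) (C : ℝ≥0), 0 < ε ∧ ∀ δ, 0 < δ → δ < ε → ∀ u : Eucl d → ℂ, IsTest u →
      eLpNorm u 2 (surfaceMeasure Ω) ^ 2 ≤
        C * (ENNReal.ofReal (2 / δ) * eLpNorm u 2 (volume.restrict Ω) ^ 2 +
          ENNReal.ofReal (2 * δ) * eLpNorm (classicalGradient u) 2 (volume.restrict Ω) ^ 2) := by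
  obtain ⟨ε, C, hε, h⟩ := hΩ.exists_trace_bound hd
  refine ⟨ε, C, hε, fun δ h0 hδ u hu => ?_⟩
  simp only [eLpNorm_two_sq]
  exact h δ h0 hδ u hu.1

theorem IsLipschitzDomain.memLp_surfaceMeasure (hd : 1 ≤ d) (hΩ : IsLipschitzDomain Ω)
    {u : Eucl d → ℂ} (hu : IsTest u) : MemLp u 2 (surfaceMeasure Ω) := by
  obtain ⟨ε, C, hε, h⟩ := hΩ.exists_eLpNorm_trace_bound hd
  refine ⟨hu.1.continuous.aestronglyMeasurable, ?_⟩
  have h1 := (h (ε / 2) (half_pos hε) (half_lt_self hε) u hu).trans_lt (c := ⊤) (by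
    refine ENNReal.mul_lt_top ENNReal.coe_lt_top (ENNReal.add_lt_top.2 ⟨?_, ?_⟩)
    · exact ENNReal.mul_lt_top ENNReal.ofReal_lt_top (ENNReal.pow_lt_top hu.memLp.2)
    · exact ENNReal.mul_lt_top ENNReal.ofReal_lt_top (ENNReal.pow_lt_top hu.memLp_gradient.2))
  exact (ENNReal.pow_lt_top_iff.1 h1).resolve_right two_ne_zero

/-- The restrictions of test functions to `Ω`, with their gradients and boundary values. -/
noncomputable def testTriples (Ω : Set (Eucl d))
    (hσ : ∀ u : Eucl d → ℂ, IsTest u → MemLp u 2 (surfaceMeasure Ω)) :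
    Submodule ℂ (L2 Ω × L2Vec Ω × L2Bdry Ω) where
  carrier := {p | ∃ (u : Eucl d → ℂ) (hu : IsTest u),
    p = (hu.memLp.toLp u, hu.memLp_gradient.toLp _, (hσ u hu).toLp u)}
  add_mem' := by
    rintro _ _ ⟨u, hu, rfl⟩ ⟨v, hv, rfl⟩
    refine ⟨u + v, hu.add hv, ?_⟩
    simp only [Prod.mk_add_mk, ← MemLp.toLp_add, ← classicalGradient_add hu hv]
  zero_mem' := by
    have h0 : IsTest (0 : Eucl d → ℂ) := ⟨contDiff_const, HasCompactSupport.zero⟩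
    have hg : classicalGradient (0 : Eucl d → ℂ) = 0 := by
      ext x i
      simp [classicalGradient, partialDeriv]
    refine ⟨0, h0, ?_⟩
    simp only [hg, MemLp.toLp_zero]
    rfl
  smul_mem' := by
    rintro c _ ⟨u, hu, rfl⟩
    refine ⟨c • u, hu.const_smul c, ?_⟩
    simp only [Prod.smul_mk, ← MemLp.toLp_const_smul, ← classicalGradient_const_smul c hu]

variable (hσ : ∀ u : Eucl d → ℂ, IsTest u → MemLp u 2 (surfaceMeasure Ω))

theorem tendsto_toLp_iff {α E : Type*} [MeasurableSpace α] [NormedAddCommGroup E] {μ : Measure α}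
    {φ : ℕ → α → E} (hφ : ∀ k, MemLp (φ k) 2 μ) (f : Lp E 2 μ) :
    Tendsto (fun k => (hφ k).toLp (φ k)) atTop (𝓝 f) ↔
      Tendsto (fun k => eLpNorm (fun x => φ k x - f x) 2 μ) atTop (𝓝 0) := by
  have h := Lp.tendsto_Lp_iff_tendsto_eLpNorm'' (fi := atTop) φ hφ f (Lp.memLp f)
  rw [Lp.toLp_coeFn] at h
  exact h

/-- Exhibits the trace relation as a section of a closed linear subspace, so linearity and norm
bounds for the trace are inherited from test functions. -/
theorem isTrace_iff_mem_closure (f : H1 Ω) (g : L2Bdry Ω) :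
    IsTrace Ω f g ↔ ((f : L2 Ω), grad Ω f, g) ∈ (testTriples Ω hσ).topologicalClosure := by
  rw [← SetLike.mem_coe, Submodule.topologicalClosure_coe, mem_closure_iff_seq_limit]
  constructor
  · rintro ⟨φ, hφ, h1, h2, h3⟩
    refine ⟨fun k => ((IsTest.memLp (hφ k)).toLp (φ k), (IsTest.memLp_gradient (hφ k)).toLp _,
      (hσ _ (hφ k)).toLp _), fun k => ⟨φ k, hφ k, rfl⟩, ?_⟩
    exact ((tendsto_toLp_iff _ _).2 h1).prodMk_nhds
      (((tendsto_toLp_iff _ _).2 h2).prodMk_nhds ((tendsto_toLp_iff _ _).2 h3))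
  · rintro ⟨p, hp, hlim⟩
    choose φ hφ hpφ using hp
    obtain rfl : p = fun k => ((hφ k).memLp.toLp (φ k), (hφ k).memLp_gradient.toLp _,
      (hσ _ (hφ k)).toLp _) := funext hpφ
    rw [Prod.tendsto_iff, Prod.tendsto_iff] at hlim
    exact ⟨φ, hφ, (tendsto_toLp_iff (fun k => (hφ k).memLp) _).1 hlim.1,
      (tendsto_toLp_iff (fun k => (hφ k).memLp_gradient) _).1 hlim.2.1,
      (tendsto_toLp_iff (fun k => hσ _ (hφ k)) _).1 hlim.2.2⟩

theorem IsLipschitzDomain.exists_norm_trace_bound (hd : 1 ≤ d) (hΩ : IsLipschitzDomain Ω) :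
    ∃ (ε : ℝ) (C : ℝ≥0), 0 < ε ∧ ∀ δ, 0 < δ → δ < ε →
      ∀ p ∈ (testTriples Ω hσ).topologicalClosure,
        ‖p.2.2‖ ^ 2 ≤ C * (2 / δ * ‖p.1‖ ^ 2 + 2 * δ * ‖p.2.1‖ ^ 2) := by
  obtain ⟨ε, C, hε, h⟩ := hΩ.exists_eLpNorm_trace_bound hd
  refine ⟨ε, C, hε, fun δ h0 hδ => ?_⟩
  have hcl : IsClosed {p : L2 Ω × L2Vec Ω × L2Bdry Ω |
      ‖p.2.2‖ ^ 2 ≤ C * (2 / δ * ‖p.1‖ ^ 2 + 2 * δ * ‖p.2.1‖ ^ 2)} :=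
    isClosed_le (by fun_prop) (by fun_prop)
  refine fun p hp => closure_minimal ?_ hcl hp
  rintro _ ⟨u, hu, rfl⟩
  have h1 := h δ h0 hδ u hu
  have t1 := (hu.memLp (Ω := Ω)).2.ne
  have t2 := (hu.memLp_gradient (Ω := Ω)).2.ne
  have h2 := ENNReal.toReal_mono (by finiteness) h1
  rw [ENNReal.toReal_mul, ENNReal.toReal_add (by finiteness) (by finiteness), ENNReal.toReal_mul,
    ENNReal.toReal_mul, ENNReal.toReal_pow, ENNReal.toReal_pow, ENNReal.toReal_pow,
    ENNReal.toReal_ofReal (by positivity), ENNReal.toReal_ofReal (by positivity),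
    ENNReal.coe_toReal] at h2
  simpa only [Set.mem_ofPred_eq, Lp.norm_toLp] using h2

/-- The trace inequality applied to differences makes the boundary values of an H¹-approximating
sequence Cauchy in L²(∂Ω). -/
theorem IsLipschitzDomain.exists_mem_closure_testTriples (hd : 1 ≤ d) (hΩ : IsLipschitzDomain Ω)
    (f : H1 Ω) :
    ∃ g : L2Bdry Ω, ((f : L2 Ω), grad Ω f, g) ∈ (testTriples Ω hσ).topologicalClosure := by
  have hap := hΩ.approximable (isWeakGradient_grad hΩ.isOpen f)
  choose u hu hu1 hu2 using fun k : ℕ => hap (k + 1 : ℝ≥0∞)⁻¹ (by simp [ENNReal.inv_eq_zero])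
  have h0 : Tendsto (fun k : ℕ => ((k + 1 : ℝ≥0∞))⁻¹) atTop (𝓝 0) := by
    have := (tendsto_add_atTop_iff_nat 1).2 ENNReal.tendsto_inv_nat_nhds_zero
    exact this.congr fun k => by push_cast; rfl
  have l1 := (tendsto_toLp_iff (fun k => (hu k).memLp) (f : L2 Ω)).2
    (tendsto_of_tendsto_of_tendsto_of_le_of_le tendsto_const_nhds h0 (fun _ => zero_le) hu1)
  have l2 := (tendsto_toLp_iff (fun k => (hu k).memLp_gradient) (grad Ω f)).2
    (tendsto_of_tendsto_of_tendsto_of_le_of_le tendsto_const_nhds h0 (fun _ => zero_le) hu2)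
  set p : ℕ → L2 Ω × L2Vec Ω × L2Bdry Ω := fun k => ((hu k).memLp.toLp (u k),
    (hu k).memLp_gradient.toLp _, (hσ _ (hu k)).toLp _) with hp
  have hpm : ∀ k, p k ∈ testTriples Ω hσ := fun k => ⟨u k, hu k, rfl⟩
  obtain ⟨ε, C, hε, hb⟩ := hΩ.exists_norm_trace_bound hσ hd
  set δ := ε / 2 with hδ
  have hδ0 : 0 < δ := half_pos hε
  have hc : CauchySeq fun k => (p k).2.2 := by
    rw [Metric.cauchySeq_iff]
    intro η hη
    have c1 := Metric.cauchySeq_iff.1 l1.cauchySeq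
    have c2 := Metric.cauchySeq_iff.1 l2.cauchySeq
    -- Errors below η/K in function and gradient give at most (K − 1)η²/K² < η² on the boundary.
    set K := C * (2 / δ + 2 * δ) + 1 with hK
    have hKpos : 0 < K := by positivity
    obtain ⟨N1, hN1⟩ := c1 (η / K) (by positivity)
    obtain ⟨N2, hN2⟩ := c2 (η / K) (by positivity)
    refine ⟨max N1 N2, fun m hm n hn => ?_⟩
    have e1 := hN1 m (le_of_max_le_left hm) n (le_of_max_le_left hn)
    have e2 := hN2 m (le_of_max_le_right hm) n (le_of_max_le_right hn)
    have e3 := hb δ hδ0 (half_lt_self hε) (p m - p n)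
      (Submodule.le_topologicalClosure _ (sub_mem (hpm m) (hpm n)))
    rw [dist_eq_norm] at e1 e2 ⊢
    change ‖(p m - p n).1‖ < _ at e1
    change ‖(p m - p n).2.1‖ < _ at e2
    change ‖(p m - p n).2.2‖ < _
    refine lt_of_pow_lt_pow_left₀ 2 hη.le (lt_of_le_of_lt e3 ?_)
    have e1' := pow_le_pow_left₀ (norm_nonneg _) e1.le 2
    have e2' := pow_le_pow_left₀ (norm_nonneg _) e2.le 2
    have e4 : C * (2 / δ * ‖(p m - p n).1‖ ^ 2 + 2 * δ * ‖(p m - p n).2.1‖ ^ 2) ≤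
        C * (2 / δ * (η / K) ^ 2 + 2 * δ * (η / K) ^ 2) := by gcongr
    refine lt_of_le_of_lt e4 ?_
    have e5 : C * (2 / δ * (η / K) ^ 2 + 2 * δ * (η / K) ^ 2) = (K - 1) / K * (1 / K) * η ^ 2 := by
      rw [hK]
      ring
    have hK1 : 1 ≤ K := by
      rw [hK]
      have : 0 ≤ C * (2 / δ + 2 * δ) := by positivity
      linarith
    have e6 : (K - 1) / K * (1 / K) < 1 := by
      rw [div_mul_div_comm, mul_one, div_lt_one (by positivity)]
      nlinarith
    rw [e5]
    have : 0 < η ^ 2 := by positivity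
    nlinarith
  obtain ⟨g, hg⟩ := cauchySeq_tendsto_of_complete hc
  refine ⟨g, ?_⟩
  rw [← SetLike.mem_coe, Submodule.topologicalClosure_coe]
  exact mem_closure_of_tendsto (l1.prodMk_nhds (l2.prodMk_nhds hg))
    (Eventually.of_forall fun k => hpm k)

/-- The difference of the two triples is (0, 0, g − g'), and the trace bound kills its last entry.
-/
theorem IsLipschitzDomain.isTrace_unique (hd : 1 ≤ d) (hΩ : IsLipschitzDomain Ω) {f : H1 Ω}
    {g g' : L2Bdry Ω} (h : IsTrace Ω f g) (h' : IsTrace Ω f g') : g = g' := by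
  have hσ : ∀ u : Eucl d → ℂ, IsTest u → MemLp u 2 (surfaceMeasure Ω) := fun u hu =>
    hΩ.memLp_surfaceMeasure hd hu
  rw [isTrace_iff_mem_closure hσ] at h h'
  obtain ⟨ε, C, hε, hb⟩ := hΩ.exists_norm_trace_bound hσ hd
  have := hb (ε / 2) (half_pos hε) (half_lt_self hε) _ (sub_mem h h')
  simp only [Prod.mk_sub_mk, sub_self, norm_zero] at this
  rw [← sub_eq_zero, ← norm_eq_zero, ← sq_eq_zero_iff]
  refine le_antisymm (this.trans (le_of_eq (by ring))) (sq_nonneg _)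

theorem IsLipschitzDomain.isTrace_trace (hd : 1 ≤ d) (hΩ : IsLipschitzDomain Ω) (f : H1 Ω) :
    IsTrace Ω f (trace Ω f) := by
  have hσ : ∀ u : Eucl d → ℂ, IsTest u → MemLp u 2 (surfaceMeasure Ω) := fun u hu =>
    hΩ.memLp_surfaceMeasure hd hu
  suffices h : ∃ T : H1 Ω →ₗ[ℂ] L2Bdry Ω, ∀ f, IsTrace Ω f (T f) by
    rw [trace, dif_pos h]
    exact h.choose_spec f
  choose T hT using hΩ.exists_mem_closure_testTriples hσ hd
  refine ⟨{ toFun := T, map_add' := fun f g => ?_, map_smul' := fun c f => ?_ }, fun f =>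
    (isTrace_iff_mem_closure hσ _ _).2 (hT f)⟩
  · refine hΩ.isTrace_unique hd ((isTrace_iff_mem_closure hσ _ _).2 (hT (f + g)))
      ((isTrace_iff_mem_closure hσ _ _).2 ?_)
    rw [map_add]
    exact add_mem (hT f) (hT g)
  · refine hΩ.isTrace_unique hd ((isTrace_iff_mem_closure hσ _ _).2 (hT (c • f)))
      ((isTrace_iff_mem_closure hσ _ _).2 ?_)
    rw [map_smul]
    exact Submodule.smul_mem _ c (hT f)

theorem IsLipschitzDomain.norm_trace_sq_le (hd : 1 ≤ d) (hΩ : IsLipschitzDomain Ω) :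
    ∀ ε > 0, ∃ C : ℝ, ∀ f : H1 Ω, ‖trace Ω f‖ ^ 2 ≤ ε * ‖grad Ω f‖ ^ 2 + C * ‖f‖ ^ 2 := by
  intro ε hε
  have hσ : ∀ u : Eucl d → ℂ, IsTest u → MemLp u 2 (surfaceMeasure Ω) := fun u hu =>
    hΩ.memLp_surfaceMeasure hd hu
  obtain ⟨ε₀, C, hε₀, hb⟩ := hΩ.exists_norm_trace_bound hσ hd
  -- The first entry keeps δ below the chart scale, the second gives 2Cδ ≤ ε.
  set δ := min (ε₀ / 2) (ε / (2 * (C + 1))) with hδ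
  have hδ0 : 0 < δ := by positivity
  refine ⟨C * (2 / δ), fun f => ?_⟩
  have h1 := hb δ hδ0 ((min_le_left _ _).trans_lt (half_lt_self hε₀)) _
    ((isTrace_iff_mem_closure hσ _ _).1 (hΩ.isTrace_trace hd f))
  have h2 : C * (2 * δ) ≤ ε := by
    have h3 : δ * (2 * (C + 1)) ≤ ε := (le_div_iff₀ (by positivity)).1 (min_le_right _ _)
    nlinarith
  have h4 := mul_le_mul_of_nonneg_right h2 (sq_nonneg ‖grad Ω f‖)
  refine h1.trans ?_
  change C * (2 / δ * ‖f‖ ^ 2 + 2 * δ * ‖grad Ω f‖ ^ 2) ≤ _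
  linarith

/-- Projection to the first coordinates is 1-Lipschitz and maps a piece of the boundary onto a
nonempty open subset of ℝᵈ⁻¹, so that piece cannot have measure zero. -/
theorem IsLipschitzDomain.euclideanHausdorffMeasure_frontier_inter_ball_ne_zero
    (hΩ : IsLipschitzDomain Ω) {p : Eucl d} (hp : p ∈ frontier Ω) {r : ℝ} (hr : 0 < r) :
    Measure.euclideanHausdorffMeasure (d - 1) (frontier Ω ∩ Metric.ball p r) ≠ 0 := by
  obtain ⟨ε, N, M, ι, _, U, hε, hUo, hcov, -, hchart⟩ := hΩ.exists_cover
  obtain ⟨j, hj⟩ := hcov p hp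
  obtain ⟨e, ψ, hψ, hU⟩ := hchart j
  have hpU : p ∈ U j := hj (Metric.mem_ball_self hε)
  have hγ := (lipschitzWith_graphPoint (e := e) hψ).continuous
  set A := graphPoint e ψ ⁻¹' (U j ∩ Metric.ball p r) with hA
  have hAo : IsOpen A := ((hUo j).inter Metric.isOpen_ball).preimage hγ
  have hAn : A.Nonempty := by
    refine ⟨(e p).fst, ?_⟩
    have h1 := snd_eq_of_mem_frontier hΩ.isOpen (hUo j) hψ.continuous hU hp hpU
    have h2 : graphPoint e ψ (e p).fst = p := by rw [graphPoint, h1, coordPoint_apply]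
    rw [hA, Set.mem_preimage, h2]
    exact ⟨hpU, Metric.mem_ball_self hr⟩
  have hsub : graphPoint e ψ '' A ⊆ frontier Ω ∩ Metric.ball p r := by
    rintro _ ⟨x, hx, rfl⟩
    exact ⟨graphPoint_mem_frontier hΩ.isOpen (hUo j) hU hx.1, hx.2⟩
  have hπ : LipschitzWith 1 fun q => (e q).fst := by
    refine LipschitzWith.of_dist_le_mul fun x y => ?_
    rw [NNReal.coe_one, one_mul, ← e.dist_eq x y]
    exact WithLp.dist_fst_le _ _
  have himg : (fun q => (e q).fst) '' (graphPoint e ψ '' A) = A := by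
    rw [Set.image_image]
    simp [graphPoint, apply_coordPoint]
  have h1 := euclideanHausdorffMeasure_image_le_of_lipschitzWith hπ (d - 1) (graphPoint e ψ '' A)
  rw [himg, EuclideanSpace.euclideanHausdorffMeasure_eq_volume, ENNReal.coe_one, one_pow,
    one_mul] at h1
  have h2 : 0 < volume A := hAo.measure_pos volume hAn
  exact (h2.trans_le (h1.trans (measure_mono hsub))).ne'

/-- Take a bump function equal to 1 near a boundary point. A test function has its own restriction
as trace, and this one is 1 on a set of positive surface measure. -/
theorem IsLipschitzDomain.exists_trace_ne_zero (hd : 1 ≤ d) (hΩ : IsLipschitzDomain Ω)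
    (hne : Ω ≠ Set.univ) : ∃ f : H1 Ω, trace Ω f ≠ 0 := by
  have hσ : ∀ u : Eucl d → ℂ, IsTest u → MemLp u 2 (surfaceMeasure Ω) := fun u hu =>
    hΩ.memLp_surfaceMeasure hd hu
  obtain ⟨p, hp⟩ : (frontier Ω).Nonempty := nonempty_frontier_iff.2 ⟨hΩ.nonempty, hne⟩
  let b : ContDiffBump p := ⟨1, 2, one_pos, one_lt_two⟩
  have hu : IsTest fun x => ((b x : ℝ) : ℂ) := isTest_ofReal b.contDiff b.hasCompactSupport
  obtain ⟨f, hf1, hf2⟩ := (hu.isWeakGradient (Ω := Ω)).exists_grad_eq hΩ.isOpen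
  refine ⟨f, fun h0 => ?_⟩
  have h1 : IsTrace Ω f ((hσ _ hu).toLp _) := by
    rw [isTrace_iff_mem_closure hσ, hf1, hf2]
    exact Submodule.le_topologicalClosure _ ⟨_, hu, rfl⟩
  have h2 := hΩ.isTrace_unique hd h1 (hΩ.isTrace_trace hd f)
  rw [h0, Lp.eq_zero_iff_ae_eq_zero] at h2
  replace h2 := (hσ _ hu).coeFn_toLp.symm.trans h2
  refine hΩ.euclideanHausdorffMeasure_frontier_inter_ball_ne_zero hp one_pos ?_
  have h3 : surfaceMeasure Ω (Metric.ball p 1) = 0 := by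
    refine measure_mono_null (fun x hx => ?_) h2
    have : b x = 1 := b.one_of_mem_closedBall (Metric.ball_subset_closedBall hx)
    simp [this]
  rwa [surfaceMeasure, Measure.restrict_apply Metric.isOpen_ball.measurableSet,
    Set.inter_comm] at h3

end Trace

/-! ### The Robin Laplacian -/

section Robin

variable {d : ℕ} {Ω : Set (Eucl d)}

theorem mem_graph_robinLaplacian (hΩ : IsOpen Ω) (β : ℝ) (p : L2 Ω × L2 Ω) :
    p ∈ (robinLaplacian Ω β).graph ↔ ∃ f : H1 Ω, (f : L2 Ω) = p.1 ∧
      ∀ v : H1 Ω, energyForm (grad Ω) (trace Ω) β f v = inner ℂ (v : L2 Ω) p.2 := by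
  rw [robinLaplacian, Submodule.toLinearPMap_graph_eq]
  · rfl
  · rintro ⟨x, y⟩ ⟨f, hf, hfv⟩ (rfl : x = 0)
    obtain rfl : f = 0 := Subtype.ext hf
    refine eq_zero_of_forall_inner_eq_zero hΩ fun v => ?_
    rw [← hfv v]
    simp [robinForm]

/-- The infimum of the Robin form over the unit sphere. -/
noncomputable def formBottom (Ω : Set (Eucl d)) (β : ℝ) : ℝ :=
  ⨅ f : {f : H1 Ω // ‖(f : L2 Ω)‖ = 1}, (‖grad Ω f‖ ^ 2 - β * ‖trace Ω f‖ ^ 2)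

theorem IsLipschitzDomain.trace_sq_le_on_sphere (hd : 1 ≤ d) (hΩ : IsLipschitzDomain Ω) :
    ∀ ε > 0, ∃ C, ∀ f : {f : H1 Ω // ‖(f : L2 Ω)‖ = 1},
      ‖trace Ω f‖ ^ 2 ≤ ε * ‖grad Ω f‖ ^ 2 + C := by
  intro ε hε
  obtain ⟨C, hC⟩ := hΩ.norm_trace_sq_le hd ε hε
  refine ⟨C, fun f => ?_⟩
  have h : ‖(f : H1 Ω)‖ = 1 := f.2
  have := hC f
  rwa [h, one_pow, mul_one] at this

theorem exists_unit_smul {f : H1 Ω} (hf : f ≠ 0) :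
    ∃ g : {f : H1 Ω // ‖(f : L2 Ω)‖ = 1}, (g : H1 Ω) = ((‖f‖⁻¹ : ℝ) : ℂ) • f := by
  refine ⟨⟨((‖f‖⁻¹ : ℝ) : ℂ) • f, ?_⟩, rfl⟩
  have h : ‖((‖f‖⁻¹ : ℝ) : ℂ) • f‖ = 1 := by
    rw [norm_smul, Complex.norm_real, norm_inv, norm_norm, inv_mul_cancel₀ (norm_ne_zero_iff.2 hf)]
  exact h

theorem IsLipschitzDomain.exists_unit_trace_pos (hd : 1 ≤ d) (hΩ : IsLipschitzDomain Ω)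
    (hne : Ω ≠ Set.univ) :
    ∃ f : {f : H1 Ω // ‖(f : L2 Ω)‖ = 1}, 0 < ‖trace Ω f‖ ^ 2 := by
  obtain ⟨f, hf⟩ := hΩ.exists_trace_ne_zero hd hne
  have hf0 : f ≠ 0 := fun h => hf (by rw [h, map_zero])
  obtain ⟨g, hg⟩ := exists_unit_smul hf0
  refine ⟨g, ?_⟩
  rw [hg, map_smul, norm_smul, Complex.norm_real, norm_inv, norm_norm]
  have h1 := norm_pos_iff.2 hf
  have h2 := norm_pos_iff.2 hf0
  positivity

theorem IsLipschitzDomain.formBottom_mul_le (hd : 1 ≤ d) (hΩ : IsLipschitzDomain Ω) (β : ℝ)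
    (f : H1 Ω) : formBottom Ω β * ‖f‖ ^ 2 ≤ ‖grad Ω f‖ ^ 2 - β * ‖trace Ω f‖ ^ 2 := by
  by_cases hf : f = 0
  · simp [hf]
  obtain ⟨g, hg⟩ := exists_unit_smul hf
  have h := ciInf_le (bddBelow_range_sub_mul (fun _ => sq_nonneg _) (fun _ => sq_nonneg _)
    (hΩ.trace_sq_le_on_sphere hd) β) g
  have hpos := norm_pos_iff.2 hf
  rw [hg, map_smul, map_smul, norm_smul, norm_smul, Complex.norm_real, norm_inv, norm_norm] at h
  have h2 := mul_le_mul_of_nonneg_right h (sq_nonneg ‖f‖)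
  refine h2.trans (le_of_eq ?_)
  field_simp

theorem IsLipschitzDomain.isLeast_spectrum (hd : 1 ≤ d) (hΩ : IsLipschitzDomain Ω)
    (hne : Ω ≠ Set.univ) (β : ℝ) :
    IsLeast {t : ℝ | (t : ℂ) ∈ spectrumPMap (robinLaplacian Ω β)} (formBottom Ω β) := by
  have : Nonempty {f : H1 Ω // ‖(f : L2 Ω)‖ = 1} :=
    ⟨(hΩ.exists_unit_trace_pos hd hne).choose⟩
  refine ⟨?_, fun t ht => ?_⟩
  · refine ofReal_mem_spectrumPMap (mem_graph_robinLaplacian hΩ.isOpen β)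
      (hΩ.formBottom_mul_le hd β) fun ε hε => ?_
    obtain ⟨f, hf⟩ := exists_lt_of_ciInf_lt (lt_add_of_pos_right (formBottom Ω β) hε)
    exact ⟨f, f.2, hf⟩
  · exact le_of_mem_spectrumPMap (isClosed_graph_grad hΩ.isOpen) (hΩ.norm_trace_sq_le hd)
      (mem_graph_robinLaplacian hΩ.isOpen β) (hΩ.formBottom_mul_le hd β) ht

theorem IsLipschitzDomain.isGLB_form (hd : 1 ≤ d) (hΩ : IsLipschitzDomain Ω)
    (hne : Ω ≠ Set.univ) (β : ℝ) :
    IsGLB {t : ℝ | ∃ f : H1 Ω, ‖(f : L2 Ω)‖ = 1 ∧ robinForm Ω β f f = (t : ℂ)}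
      (formBottom Ω β) := by
  have : Nonempty {f : H1 Ω // ‖(f : L2 Ω)‖ = 1} :=
    ⟨(hΩ.exists_unit_trace_pos hd hne).choose⟩
  have h := isGLB_ciInf (bddBelow_range_sub_mul (fun _ => sq_nonneg _) (fun _ => sq_nonneg _)
    (hΩ.trace_sq_le_on_sphere hd) β)
  suffices hset : {t : ℝ | ∃ f : H1 Ω, ‖(f : L2 Ω)‖ = 1 ∧ robinForm Ω β f f = (t : ℂ)} =
      Set.range fun f : {f : H1 Ω // ‖(f : L2 Ω)‖ = 1} =>
        ‖grad Ω f‖ ^ 2 - β * ‖trace Ω f‖ ^ 2 by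
    rw [hset]
    exact h
  ext t
  constructor
  · rintro ⟨f, hf, ht⟩
    refine ⟨⟨f, hf⟩, ?_⟩
    have h1 := (energyForm_self (grad Ω) (trace Ω) β f).symm.trans ht
    exact_mod_cast h1
  · rintro ⟨f, rfl⟩
    exact ⟨f, f.2, energyForm_self (grad Ω) (trace Ω) β f⟩

theorem IsLipschitzDomain.bottom_eq_formBottom (hd : 1 ≤ d) (hΩ : IsLipschitzDomain Ω)
    (hne : Ω ≠ Set.univ) : bottom Ω = formBottom Ω :=
  funext fun β => (hΩ.isLeast_spectrum hd hne β).csInf_eq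

end Robin

end RobinLaplacian

/-! ### The main theorem -/

theorem mainTheorem7 (d : ℕ) (hd : 2 ≤ d) (Ω : Set (RobinLaplacian.Eucl d))
    (hΩ : RobinLaplacian.IsLipschitzDomain Ω) (hne : Ω ≠ Set.univ) :
    -- `F_Ω(β)` is a genuine infimum, of the spectrum and of the form
    (∀ β : ℝ, 0 ≤ β →
      (∀ z ∈ RobinLaplacian.spectrumPMap (RobinLaplacian.robinLaplacian Ω β), z.im = 0) ∧
      {t : ℝ | (t : ℂ) ∈
        RobinLaplacian.spectrumPMap (RobinLaplacian.robinLaplacian Ω β)}.Nonempty ∧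
      IsGLB {t : ℝ | (t : ℂ) ∈ RobinLaplacian.spectrumPMap (RobinLaplacian.robinLaplacian Ω β)}
        (RobinLaplacian.bottom Ω β) ∧
      IsGLB {t : ℝ | ∃ f : RobinLaplacian.H1 Ω, ‖(f : RobinLaplacian.L2 Ω)‖ = 1 ∧
        RobinLaplacian.robinForm Ω β f f = (t : ℂ)} (RobinLaplacian.bottom Ω β)) ∧
    -- (i)
    AntitoneOn (RobinLaplacian.bottom Ω) (Set.Ici 0) ∧
    (∀ β₁ β₂ : ℝ, 0 ≤ β₁ → RobinLaplacian.bottom Ω β₁ < 0 → β₁ < β₂ →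
      RobinLaplacian.bottom Ω β₂ < RobinLaplacian.bottom Ω β₁) ∧
    -- (ii)
    ContinuousOn (RobinLaplacian.bottom Ω) (Set.Ici 0) ∧
    -- (iii)
    0 ≤ RobinLaplacian.bottom Ω 0 ∧
    -- (iv)
    Tendsto (RobinLaplacian.bottom Ω) atTop atBot ∧
    -- the root of `F_Ω(β) = -1`
    (∃! β : ℝ, 0 < β ∧ RobinLaplacian.bottom Ω β = -1) := by
  have hd1 : 1 ≤ d := one_le_two.trans hd
  have hab := hΩ.trace_sq_le_on_sphere hd1
  obtain ⟨f₀, hf₀⟩ := hΩ.exists_unit_trace_pos hd1 hne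
  have : Nonempty {f : RobinLaplacian.H1 Ω // ‖(f : RobinLaplacian.L2 Ω)‖ = 1} := ⟨f₀⟩
  have ha : ∀ f : {f : RobinLaplacian.H1 Ω // ‖(f : RobinLaplacian.L2 Ω)‖ = 1},
      0 ≤ ‖RobinLaplacian.grad Ω f‖ ^ 2 := fun _ => sq_nonneg _
  have hb : ∀ f : {f : RobinLaplacian.H1 Ω // ‖(f : RobinLaplacian.L2 Ω)‖ = 1},
      0 ≤ ‖RobinLaplacian.trace Ω f‖ ^ 2 := fun _ => sq_nonneg _
  have hanti : Antitone (RobinLaplacian.formBottom Ω) :=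
    RobinLaplacian.antitone_iInf_sub_mul ha hb hab
  have hcont : Continuous (RobinLaplacian.formBottom Ω) :=
    RobinLaplacian.continuous_iInf_sub_mul ha hb hab
  have hlim : Tendsto (RobinLaplacian.formBottom Ω) atTop atBot :=
    RobinLaplacian.tendsto_iInf_sub_mul ha hb hab hf₀
  have hstrict : ∀ β₁ β₂ : ℝ, 0 ≤ β₁ → RobinLaplacian.formBottom Ω β₁ < 0 → β₁ < β₂ →
      RobinLaplacian.formBottom Ω β₂ < RobinLaplacian.formBottom Ω β₁ := fun β₁ β₂ h0 h1 h2 =>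
    RobinLaplacian.iInf_sub_mul_lt ha hb hab h0 h1 h2
  have hzero : 0 ≤ RobinLaplacian.formBottom Ω 0 := le_ciInf fun f => by
    rw [zero_mul, sub_zero]
    exact sq_nonneg _
  rw [hΩ.bottom_eq_formBottom hd1 hne]
  refine ⟨fun β _ => ⟨fun z hz => ?_, ⟨_, (hΩ.isLeast_spectrum hd1 hne β).1⟩,
    (hΩ.isLeast_spectrum hd1 hne β).isGLB, hΩ.isGLB_form hd1 hne β⟩, hanti.antitoneOn _, hstrict,
    hcont.continuousOn, hzero, hlim, ?_⟩
  · exact RobinLaplacian.im_eq_zero_of_mem_spectrumPMap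
      (RobinLaplacian.isClosed_graph_grad hΩ.isOpen) (hΩ.norm_trace_sq_le hd1)
      (RobinLaplacian.mem_graph_robinLaplacian hΩ.isOpen β) hz
  · obtain ⟨γ, hγ⟩ := (hlim.eventually (eventually_le_atBot (-1))).exists
    obtain ⟨β, hβ⟩ := mem_range_of_exists_le_of_exists_ge hcont ⟨γ, hγ⟩
      ⟨0, (by norm_num : (-1 : ℝ) ≤ 0).trans hzero⟩
    -- Monotonicity holds on all of ℝ, so for β' ≤ 0 the value is at least that at 0, which is
    -- nonnegative.
    have hpos : ∀ β', RobinLaplacian.formBottom Ω β' = -1 → 0 < β' := fun β' h => by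
      by_contra! hle
      have := hanti hle
      linarith
    refine ⟨β, ⟨hpos β hβ, hβ⟩, fun β' hβ' => ?_⟩
    -- At the smaller of two distinct roots the value −1 is negative, so strict decrease excludes
    -- the larger one.
    rcases lt_trichotomy β' β with h | h | h
    · have := hstrict β' β hβ'.1.le (by rw [hβ'.2]; norm_num) h
      linarith [hβ'.2]
    · exact h
    · have := hstrict β β' (hpos β hβ).le (by rw [hβ]; norm_num) h
      linarith [hβ'.2]
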